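/- Let $F$ be an $m\times m$-valued real rational function (every entry is a quotient of polynomials with real coefficients) with no pole at infinity, and let $$F(z)=C(zI_n-A)^{-1}B+D,\qquad R_F=\begin{pmatrix}A&B\\ C&D\end{pmatrix}\in\mathbb C^{(n+m)\times(n+m)},$$ be a state-space realization of $F$. It is called minimal if $n$ is the McMillan degree of $F$, i.e. the least state dimension of a realization of $F$. Let $\mathbb C_R=\{z:\operatorname{Re}z>0\}$ and $\overline{\mathbb D}^c=\{z:|z|>1\}$. The real rational function $F$ is called - positive real $(l=\alpha)$ if $F$ is analytic in $\mathbb C_R$ and $F(z)+F(z)^*\ge 0$ for all $z\in\mathbb C_R$; - bounded real $(l=\beta)$ if $F$ is analytic in $\mathbb C_R$ and $I_m-F(z)^*F(z)\ge 0$ (that is, $\|F(z)\|_2\le 1$) for all $z\in\mathbb C_R$; - discrete-time positive real $(l=\gamma)$ if $F$ is analytic in $\overline{\mathbb D}^c$ and $F(z)+F(z)^*\ge 0$ for all $z\in\overline{\mathbb D}^c$; - discrete-time bounded real $(l=\delta)$ if $F$ is analytic in $\overline{\mathbb D}^c$ and $I_m-F(z)^*F(z)\ge 0$ for all $z\in\overline{\mathbb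 D}^c$. For a positive definite Hermitian $n\times n$ matrix $P$ define the $2(n+m)\times 2(n+m)$ matrices $$W_\alpha=\begin{pmatrix}0&0&-P&0\\0&0&0&I_m\\-P&0&0&0\\0&I_m&0&0\end{pmatrix},\qquad W_\beta=\begin{pmatrix}0&0&-P&0\\0&-I_m&0&0\\-P&0&0&0\\0&0&0&I_m\end{pmatrix},$$ $$W_\gamma=\begin{pmatrix}-P&0&0&0\\0&0&0&I_m\\0&0&P&0\\0&I_m&0&0\end{pmatrix},\qquad W_\delta=\begin{pmatrix}-P&0&0&0\\0&-I_m&0&0\\0&0&P&0\\0&0&0&I_m\end{pmatrix}.$$ Let $l\in\{\alpha,\beta,\gamma,\delta\}$ and consider the condition $$\begin{pmatrix}R_F\\ I_{n+m}\end{pmatrix}^{*}W_l\begin{pmatrix}R_F\\ I_{n+m}\end{pmatrix}\ \text{ is positive semidefinite.}\tag{1}$$ (I) If (1) holds for some positive definite $P$, then $F$ is positive real if $l=\alpha$, bounded real if $l=\beta$, discrete-time positive real if $l=\gamma$, and discrete-time bounded real if $l=\delta$. (II) Conversely, if the realization $R_F$ is minimal and $F$ belongs to the family with label $l$, then there is a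 positive definite $P$ for which (1) holds. If moreover $R_F$ is a real matrix, then $P$ can be chosen real (symmetric). -/

import Mathlib

open Matrix
open scoped ComplexOrder

namespace KYP

noncomputable section

/-- The matrix `M` stacked on top of the identity matrix of the same size. -/
def stackOne {ι : Type*} [DecidableEq ι] (M : Matrix ι ι ℂ) : Matrix (ι ⊕ ι) ι ℂ :=
  fromRows M (1 : Matrix ι ι ℂ)

/-! ### The matrix sets cut out by the Lyapunov and Stein inclusions -/

/-- The closed set of matrices `M` with `(M; I)^* (0 H; H 0) (M; I)` positive semidefinite;
for `H = I` the condition reads `M + M^* ≥ 0`. -/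
def lyapunovSet {k : ℕ} (H : Matrix (Fin k) (Fin k) ℂ) : Set (Matrix (Fin k) (Fin k) ℂ) :=
  {M | ((stackOne M)ᴴ * fromBlocks 0 H H 0 * stackOne M).PosSemidef}

/-- The closed set of matrices `M` with `(M; I)^* (-H 0; 0 H) (M; I)` positive semidefinite;
for `H = I` the condition reads `I - M^* M ≥ 0`, i.e. the spectral norm of `M` is at most `1`. -/
def steinSet {k : ℕ} (H : Matrix (Fin k) (Fin k) ℂ) : Set (Matrix (Fin k) (Fin k) ℂ) :=
  {M | ((stackOne M)ᴴ * fromBlocks (-H) 0 0 H * stackOne M).PosSemidef}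

/-! ### Rational matrix functions and the four families -/

/-- An `m × m`-valued rational function of one complex variable. -/
abbrev RatMat (m : ℕ) : Type := Matrix (Fin m) (Fin m) (RatFunc ℂ)

/-- `F` is a real rational function: every entry is a quotient of real polynomials. -/
def IsRealRational {m : ℕ} (F : RatMat m) : Prop :=
  ∀ i j, ∃ p q : Polynomial ℝ, q ≠ 0 ∧
    F i j = algebraMap (Polynomial ℂ) (RatFunc ℂ) (p.map Complex.ofRealHom) /
      algebraMap (Polynomial ℂ) (RatFunc ℂ) (q.map Complex.ofRealHom)

/-- `F` has no pole at `z` (`RatFunc.denom` is the denominator in lowest terms). -/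
def AnalyticAtPoint {m : ℕ} (F : RatMat m) (z : ℂ) : Prop :=
  ∀ i j, (F i j).denom.eval z ≠ 0

/-- The value `F(z)`, meaningful where `F` has no pole. -/
def evalAt {m : ℕ} (F : RatMat m) (z : ℂ) : Matrix (Fin m) (Fin m) ℂ :=
  F.map (RatFunc.eval (RingHom.id ℂ) z)

/-- `F` is analytic on `Ω` and maps `Ω` into `S`. -/
def MapsAnalytically {m : ℕ} (F : RatMat m) (Ω : Set ℂ) (S : Set (Matrix (Fin m) (Fin m) ℂ)) :
    Prop :=
  ∀ z ∈ Ω, AnalyticAtPoint F z ∧ evalAt F z ∈ S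

/-- The open right half plane. -/
def rightHalfPlane : Set ℂ := {z | 0 < z.re}

/-- The exterior of the closed unit disk. -/
def diskExterior : Set ℂ := {z | 1 < ‖z‖}

/-- Positive real functions. -/
def IsPositiveReal {m : ℕ} (F : RatMat m) : Prop :=
  IsRealRational F ∧ MapsAnalytically F rightHalfPlane (lyapunovSet 1)

/-- Bounded real functions. -/
def IsBoundedReal {m : ℕ} (F : RatMat m) : Prop :=
  IsRealRational F ∧ MapsAnalytically F rightHalfPlane (steinSet 1)

/-- Discrete-time positive real functions. -/
def IsDiscretePositiveReal {m : ℕ} (F : RatMat m) : Prop :=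
  IsRealRational F ∧ MapsAnalytically F diskExterior (lyapunovSet 1)

/-- Discrete-time bounded real functions. -/
def IsDiscreteBoundedReal {m : ℕ} (F : RatMat m) : Prop :=
  IsRealRational F ∧ MapsAnalytically F diskExterior (steinSet 1)

/-- The labels `α, β, γ, δ` of the four families. -/
inductive Label where
  | alpha
  | beta
  | gamma
  | delta

/-- Membership in the family with label `l`. -/
def InFamily (l : Label) {m : ℕ} (F : RatMat m) : Prop :=
  match l with
  | .alpha => IsPositiveReal F
  | .beta => IsBoundedReal F
  | .gamma => IsDiscretePositiveReal F
  | .delta => IsDiscreteBoundedReal F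

/-! ### State-space realizations -/

/-- The rational function `C (z I - A)⁻¹ B + D`; the inverse is taken over the field of rational
functions, where `z I - A` is always invertible. -/
def transferFunction {n m : ℕ} (A : Matrix (Fin n) (Fin n) ℂ) (B : Matrix (Fin n) (Fin m) ℂ)
    (C : Matrix (Fin m) (Fin n) ℂ) (D : Matrix (Fin m) (Fin m) ℂ) : RatMat m :=
  C.map RatFunc.C * ((RatFunc.X : RatFunc ℂ) • (1 : Matrix (Fin n) (Fin n) (RatFunc ℂ)) -
    A.map RatFunc.C)⁻¹ * B.map RatFunc.C + D.map RatFunc.C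

/-- `A, B, C, D` is a state-space realization of `F`. -/
def IsRealization {n m : ℕ} (A : Matrix (Fin n) (Fin n) ℂ) (B : Matrix (Fin n) (Fin m) ℂ)
    (C : Matrix (Fin m) (Fin n) ℂ) (D : Matrix (Fin m) (Fin m) ℂ) (F : RatMat m) : Prop :=
  F = transferFunction A B C D

/-- The McMillan degree of a rational function without pole at infinity: the least state
dimension of a realization. -/
def mcMillanDegree {m : ℕ} (F : RatMat m) : ℕ :=
  sInf {k : ℕ | ∃ (A : Matrix (Fin k) (Fin k) ℂ) (B : Matrix (Fin k) (Fin m) ℂ)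
    (C : Matrix (Fin m) (Fin k) ℂ) (D : Matrix (Fin m) (Fin m) ℂ), IsRealization A B C D F}

/-- A realization is minimal if its state dimension is the McMillan degree. -/
def IsMinimalRealization {n m : ℕ} (A : Matrix (Fin n) (Fin n) ℂ) (B : Matrix (Fin n) (Fin m) ℂ)
    (C : Matrix (Fin m) (Fin n) ℂ) (D : Matrix (Fin m) (Fin m) ℂ) (F : RatMat m) : Prop :=
  IsRealization A B C D F ∧ n = mcMillanDegree F

/-! ### The indefinite matrices and the quadratic matrix inclusion -/

/-- The `2(n+m) × 2(n+m)` matrices `W_l`, in blocks of sizes `n, m, n, m`. -/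
def W (l : Label) {n : ℕ} (m : ℕ) (P : Matrix (Fin n) (Fin n) ℂ) :
    Matrix ((Fin n ⊕ Fin m) ⊕ (Fin n ⊕ Fin m)) ((Fin n ⊕ Fin m) ⊕ (Fin n ⊕ Fin m)) ℂ :=
  match l with
  | .alpha => fromBlocks 0 (fromBlocks (-P) 0 0 1) (fromBlocks (-P) 0 0 1) 0
  | .beta => fromBlocks (fromBlocks 0 0 0 (-1)) (fromBlocks (-P) 0 0 0)
      (fromBlocks (-P) 0 0 0) (fromBlocks 0 0 0 1)
  | .gamma => fromBlocks (fromBlocks (-P) 0 0 0) (fromBlocks 0 0 0 1)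
      (fromBlocks 0 0 0 1) (fromBlocks P 0 0 0)
  | .delta => fromBlocks (fromBlocks (-P) 0 0 (-1)) 0 0 (fromBlocks P 0 0 1)

/-- The `(n+m) × (n+m)` matrix `Q_l = (R; I)^* W_l (R; I)`, where `R = (A B; C D)`. -/
def Q (l : Label) {n m : ℕ} (P : Matrix (Fin n) (Fin n) ℂ)
    (A : Matrix (Fin n) (Fin n) ℂ) (B : Matrix (Fin n) (Fin m) ℂ)
    (C : Matrix (Fin m) (Fin n) ℂ) (D : Matrix (Fin m) (Fin m) ℂ) :
    Matrix (Fin n ⊕ Fin m) (Fin n ⊕ Fin m) ℂ :=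
  (stackOne (fromBlocks A B C D))ᴴ * W l m P * stackOne (fromBlocks A B C D)

/-- All entries of the matrix are real. -/
def IsRealMatrix {ι κ : Type*} (M : Matrix ι κ ℂ) : Prop := ∀ i j, (M i j).im = 0

end

end KYP

/-! Read `x` as a state, `u` as an input and `y = C x + D u` as the output. Condition (1) is then a
dissipation inequality: the storage `x^* P x` grows no faster than the supplied energy, which is `2
Re u^* y` in the positive real cases and `|u|² - |y|²` in the bounded real ones.

For (I), insert the exponential solution `A x + B u = z x`, for which `y = F(z) u`. For `z` in the
region the storage term has a sign, and what remains is the required inequality for `F(z)`. Taking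
`u = 0` shows that `A` has no eigenvalue in the region, so `F` has no pole there.

For (II), the core case is discrete-time and positive real. Averaging `û^* F(1/w) û` over circles,
with `û` the generating polynomial of a finite input, shows that no energy can be extracted from
rest (`toeplitz_nonneg`). Following Willems, the storage is the supremum of the energy that can be
extracted from `x` (`exists_storage`). Controllability makes it finite and observability makes it
definite. It obeys the parallelogram law and is convex, so by Jordan and von Neumann it is a
Hermitian form, whose matrix is `P`.

The other cases reduce to this one. A Cayley transformation of the state equations carries the half
plane to the disc (`exists_storage_of_rightHalfPlane`). The matrix `(1 2M; 0 1)` has nonnegative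
Hermitian part exactly when `M` is a contraction, which turns bounded real into positive real with
the same `A`. Minimality yields controllability and observability by restriction to, or quotient by,
an invariant subspace. For real data, `P` is averaged with its transpose. -/

namespace KYP

open Filter Topology Metric Real

/-! ### Taylor coefficients on circles and the Toeplitz form of a positive real function -/

section Moments

variable {ν ι : Type*} [Fintype ν] [DecidableEq ν] [Fintype ι]

theorem continuousAt_inv_one_sub_smul (A : Matrix ν ν ℂ) :
    ContinuousAt (fun w : ℂ => (1 - w • A)⁻¹) 0 := by
  have h1 : ContinuousAt (fun w : ℂ => 1 - w • A) 0 := by fun_prop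
  have h2 : ContinuousAt (fun w : ℂ => (1 - w • A).det) 0 :=
    (Continuous.matrix_det (by fun_prop)).continuousAt
  have h3 : ContinuousAt (fun w : ℂ => (1 - w • A).adjugate) 0 :=
    (Continuous.matrix_adjugate (by fun_prop)).continuousAt
  simp only [Matrix.inv_def, Ring.inverse_eq_inv']
  exact (h2.inv₀ (by simp)).smul h3

theorem eventually_isUnit_det_one_sub_smul (A : Matrix ν ν ℂ) :
    ∀ᶠ w : ℂ in 𝓝 0, IsUnit (1 - w • A).det := by
  have h2 : ContinuousAt (fun w : ℂ => (1 - w • A).det) 0 :=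
    (Continuous.matrix_det (by fun_prop)).continuousAt
  filter_upwards [h2.eventually_ne (by simp : (1 - (0 : ℂ) • A).det ≠ 0)] with w hw
  exact isUnit_iff_ne_zero.2 hw

/-- The scalar Markov parameters, i.e. the Taylor coefficients at `0` of
`d + w c (1 - w A)⁻¹ b`. -/
def scalarMarkov (A : Matrix ν ν ℂ) (b : ν → ℂ) (c : ν → ℂ) (d : ℂ) : ℕ → ℂ
  | 0 => d
  | k + 1 => c ⬝ᵥ (A ^ k *ᵥ b)

theorem apply_zero_of_eventually_resolvent {A : Matrix ν ν ℂ} {b c : ν → ℂ} {d : ℂ} {φ : ℂ → ℂ}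
    (hφ : ContinuousAt φ 0)
    (h : ∀ᶠ w in 𝓝[≠] 0, φ w = d + w * (c ⬝ᵥ ((1 - w • A)⁻¹ *ᵥ b))) : φ 0 = d := by
  have hR : ContinuousAt (fun w : ℂ => d + w * (c ⬝ᵥ ((1 - w • A)⁻¹ *ᵥ b))) 0 := by
    have := continuousAt_inv_one_sub_smul A
    have h2 : Continuous fun M : Matrix ν ν ℂ => c ⬝ᵥ (M *ᵥ b) := by fun_prop
    have h3 : ContinuousAt (fun w : ℂ => c ⬝ᵥ ((1 - w • A)⁻¹ *ᵥ b)) 0 :=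
      h2.continuousAt.comp this
    fun_prop
  have h1 : Tendsto φ (𝓝[≠] 0) (𝓝 (φ 0)) := hφ.tendsto.mono_left nhdsWithin_le_nhds
  have h2 := (hR.tendsto.mono_left (nhdsWithin_le_nhds (s := {0}ᶜ))).congr'
    (h.mono fun _ h => h.symm)
  simpa using tendsto_nhds_unique h1 h2

theorem continuousOn_sphere_of_differentiableOn {f : ℂ → ℂ} {r : ℝ} (hr1 : r < 1)
    (hf : DifferentiableOn ℂ f (ball 0 1)) : ContinuousOn f (sphere 0 r) :=
  hf.continuousOn.mono fun w hw => by
    rw [mem_sphere_zero_iff_norm] at hw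
    rw [mem_ball_zero_iff]; linarith

theorem circleAverage_pow_inv {r : ℝ} (hr : 0 < r) (j : ℕ) :
    circleAverage (fun w : ℂ => (w ^ (j + 1))⁻¹) 0 r = 0 := by
  rw [circleAverage_eq_circleIntegral hr.ne']
  -- The circle average contributes one more factor `w⁻¹`, so the exponent is `-(j + 2)`, never
  -- `-1`.
  have := circleIntegral.integral_sub_zpow_of_ne (n := -((j : ℤ) + 2)) (by omega) 0 0 r
  refine smul_eq_zero_of_right _ (Eq.trans ?_ this)
  congr 1
  ext w
  rw [smul_eq_mul, ← mul_inv, _root_.zpow_neg]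
  congr 1
  rw [sub_zero, show ((j : ℤ) + 2) = ((j + 2 : ℕ) : ℤ) by push_cast; ring, zpow_natCast]
  ring

/-- The Cauchy formula for the Taylor coefficients of a function that agrees near `0` with
`d + w c (1 - w A)⁻¹ b`. -/
theorem circleAverage_pow_inv_mul (A : Matrix ν ν ℂ) (b : ν → ℂ) {r : ℝ} (hr : 0 < r)
    (hr1 : r < 1) (j : ℕ) : ∀ (φ : ℂ → ℂ) (c : ν → ℂ) (d : ℂ),
    DifferentiableOn ℂ φ (ball 0 1) →
    (∀ᶠ w in 𝓝[≠] 0, φ w = d + w * (c ⬝ᵥ ((1 - w • A)⁻¹ *ᵥ b))) →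
    circleAverage (fun w => (w ^ j)⁻¹ * φ w) 0 r = scalarMarkov A b c d j := by
  induction j with
  | zero =>
    intro φ c d hφ h
    have hcl : DiffContOnCl ℂ φ (ball 0 |r|) := by
      refine DifferentiableOn.diffContOnCl (hφ.mono ?_)
      rw [abs_of_pos hr, closure_ball _ hr.ne']
      exact closedBall_subset_ball hr1
    simp only [pow_zero, inv_one, one_mul, scalarMarkov]
    rw [hcl.circleAverage]
    exact apply_zero_of_eventually_resolvent
      (hφ.continuousOn.continuousAt (ball_mem_nhds 0 one_pos)) h
  | succ j ih =>
    intro φ c d hφ h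
    have h0 : φ 0 = d := apply_zero_of_eventually_resolvent
      (hφ.continuousOn.continuousAt (ball_mem_nhds 0 one_pos)) h
    -- Since `(1 - w A)⁻¹ = 1 + w A (1 - w A)⁻¹`, the quotient `(φ w - φ 0) / w` has the same form
    -- with `c A` for `c` and `c b` for `d`. This is why the induction runs over all `φ`, `c`, `d`.
    -- The resolvent formula is used only near `0`, because `A` may have eigenvalues that are not
    -- poles of `φ`.
    have hψ : DifferentiableOn ℂ (dslope φ 0) (ball 0 1) :=
      (Complex.differentiableOn_dslope (ball_mem_nhds 0 one_pos)).2 hφ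
    have hnear : ∀ᶠ w in 𝓝[≠] 0, dslope φ 0 w =
        c ⬝ᵥ b + w * ((c ᵥ* A) ⬝ᵥ ((1 - w • A)⁻¹ *ᵥ b)) := by
      filter_upwards [h, self_mem_nhdsWithin,
        (eventually_isUnit_det_one_sub_smul A).filter_mono nhdsWithin_le_nhds] with w hw hw0 hdet
      have hw0' : w ≠ 0 := hw0
      rw [dslope_of_ne _ hw0', slope_def_field, hw, h0, sub_zero, add_sub_cancel_left,
        mul_div_cancel_left₀ _ hw0']
      have hinv : (1 - w • A)⁻¹ = 1 + w • (A * (1 - w • A)⁻¹) := by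
        have := Matrix.mul_nonsing_inv _ hdet
        rw [sub_mul, one_mul, smul_mul_assoc] at this
        exact sub_eq_iff_eq_add.1 this
      conv_lhs => rw [hinv]
      rw [add_mulVec, one_mulVec, dotProduct_add, smul_mulVec, dotProduct_smul, smul_eq_mul,
        ← mulVec_mulVec, dotProduct_mulVec c A]
    have key := ih (dslope φ 0) (c ᵥ* A) (c ⬝ᵥ b) hψ hnear
    have hsplit : circleAverage (fun w => (w ^ (j + 1))⁻¹ * φ w) 0 r =
        circleAverage (fun w => d • (w ^ (j + 1))⁻¹ + (w ^ j)⁻¹ * dslope φ 0 w) 0 r := by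
      refine circleAverage_congr_sphere fun w hw => ?_
      have hw0 : w ≠ 0 := by
        rintro rfl
        simp [eq_comm, hr.ne'] at hw
      simp only [dslope_of_ne _ hw0, slope_def_field, h0, sub_zero, smul_eq_mul]
      field_simp
      ring
    have hpow : ∀ k : ℕ, ContinuousOn (fun w : ℂ => (w ^ k)⁻¹) (sphere 0 |r|) := fun k =>
      (continuousOn_id.pow k).inv₀ fun w hw => pow_ne_zero _ fun h0 => by
        simp only [id] at h0
        subst h0
        simp [eq_comm, hr.ne'] at hw
    rw [hsplit, circleAverage_fun_add, circleAverage_fun_smul, circleAverage_pow_inv hr, key]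
    · cases j with
      | zero => simp [scalarMarkov]
      | succ j => simp [scalarMarkov, pow_succ', ← dotProduct_mulVec, mulVec_mulVec]
    · exact ((hpow _).const_smul d).circleIntegrable'
    · refine ContinuousOn.circleIntegrable' ((hpow j).mul ?_)
      rw [abs_of_pos hr]
      exact continuousOn_sphere_of_differentiableOn hr1 hψ

/-- On the circle `star w = r² / w`, so the integrand is `r^(2k) w^(l-k) φ w`. Its average is a
Taylor coefficient for `l ≤ k`; for `l > k` it vanishes by the mean value property. -/
theorem circleAverage_conj_pow_mul_pow_mul (A : Matrix ν ν ℂ) (b : ν → ℂ) {r : ℝ} (hr : 0 < r)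
    (hr1 : r < 1) (k l : ℕ) (φ : ℂ → ℂ) (c : ν → ℂ) (d : ℂ)
    (hφ : DifferentiableOn ℂ φ (ball 0 1))
    (h : ∀ᶠ w in 𝓝[≠] 0, φ w = d + w * (c ⬝ᵥ ((1 - w • A)⁻¹ *ᵥ b))) :
    circleAverage (fun w => star w ^ k * w ^ l * φ w) 0 r =
      if l ≤ k then (r : ℂ) ^ (2 * k) * scalarMarkov A b c d (k - l) else 0 := by
  have hconj : ∀ w ∈ sphere (0 : ℂ) |r|, w ≠ 0 ∧ star w = (r : ℂ) ^ 2 * w⁻¹ := fun w hw => by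
    have hn : ‖w‖ = r := by simpa [abs_of_pos hr] using hw
    have hw0 : w ≠ 0 := by rintro rfl; simp at hn; exact hr.ne hn
    refine ⟨hw0, ?_⟩
    rw [eq_mul_inv_iff_mul_eq₀ hw0, ← hn]
    simpa using Complex.conj_mul' w
  split_ifs with hlk
  · rw [← circleAverage_pow_inv_mul A b hr hr1 (k - l) φ c d hφ h, ← smul_eq_mul,
      ← circleAverage_fun_smul]
    refine circleAverage_congr_sphere fun w hw => ?_
    obtain ⟨hw0, hc⟩ := hconj w hw
    obtain ⟨j, rfl⟩ := Nat.exists_eq_add_of_le hlk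
    simp only [hc, smul_eq_mul, Nat.add_sub_cancel_left, mul_pow, inv_pow]
    field_simp
    ring
  · obtain ⟨j, rfl⟩ := Nat.exists_eq_add_of_lt (not_le.1 hlk)
    have hg : DifferentiableOn ℂ (fun w => (r : ℂ) ^ (2 * k) * (w ^ (j + 1) * φ w)) (ball 0 1) :=
      ((differentiableOn_id.pow _).mul hφ).const_mul _
    have hcl : DiffContOnCl ℂ (fun w => (r : ℂ) ^ (2 * k) * (w ^ (j + 1) * φ w)) (ball 0 |r|) := by
      refine DifferentiableOn.diffContOnCl (hg.mono ?_)
      rw [abs_of_pos hr, closure_ball _ hr.ne']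
      exact closedBall_subset_ball hr1
    have := hcl.circleAverage
    simp only [ne_eq, Nat.add_eq_zero_iff, one_ne_zero, and_false, not_false_eq_true, zero_pow,
      zero_mul, mul_zero] at this
    refine Eq.trans (circleAverage_congr_sphere fun w hw => ?_) this
    obtain ⟨hw0, hc⟩ := hconj w hw
    simp only [hc, mul_pow, inv_pow]
    field_simp
    ring

/-- The Markov parameters `D, CB, CAB, …`. -/
def markov {κ : Type*} (A : Matrix ν ν ℂ) (B : Matrix ν κ ℂ) (C : Matrix κ ν ℂ)
    (D : Matrix κ κ ℂ) : ℕ → Matrix κ κ ℂ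
  | 0 => D
  | k + 1 => C * A ^ k * B

theorem scalarMarkov_eq_markov {κ : Type*} (A : Matrix ν ν ℂ) (B : Matrix ν κ ℂ)
    (C : Matrix κ ν ℂ) (D : Matrix κ κ ℂ) (i j : κ) (k : ℕ) :
    scalarMarkov A (fun p => B p j) (C i) (D i j) k = markov A B C D k i j := by
  cases k with
  | zero => rfl
  | succ k =>
    rw [markov, Matrix.mul_assoc]
    rfl

/-- The state at time `k` of `x⁺ = A x + B u`, started at `x`. -/
def traj (A : Matrix ν ν ℂ) (B : Matrix ν ι ℂ) (u : ℕ → ι → ℂ) (x : ν → ℂ) : ℕ → ν → ℂ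
  | 0 => x
  | k + 1 => A *ᵥ traj A B u x k + B *ᵥ u k

theorem traj_zero_eq_sum (A : Matrix ν ν ℂ) (B : Matrix ν ι ℂ) (u : ℕ → ι → ℂ) (k : ℕ) :
    traj A B u 0 k = ∑ l ∈ Finset.range k, (A ^ (k - 1 - l) * B) *ᵥ u l := by
  induction k with
  | zero => simp [traj]
  | succ k ih =>
    rw [traj, ih, Finset.sum_range_succ, mulVec_sum]
    congr 1
    · refine Finset.sum_congr rfl fun l hl => ?_
      rw [Finset.mem_range] at hl
      rw [mulVec_mulVec, ← Matrix.mul_assoc, ← pow_succ']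
      congr 3
      omega
    · simp

theorem output_eq_sum_markov (A : Matrix ν ν ℂ) (B : Matrix ν ι ℂ) (C : Matrix ι ν ℂ)
    (D : Matrix ι ι ℂ) (u : ℕ → ι → ℂ) (k : ℕ) :
    C *ᵥ traj A B u 0 k + D *ᵥ u k =
      ∑ l ∈ Finset.range (k + 1), markov A B C D (k - l) *ᵥ u l := by
  rw [Finset.sum_range_succ, traj_zero_eq_sum, mulVec_sum]
  congr 1
  · refine Finset.sum_congr rfl fun l hl => ?_
    rw [Finset.mem_range] at hl
    obtain ⟨j, rfl⟩ := Nat.exists_eq_add_of_lt hl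
    rw [show l + j + 1 - l = j + 1 by omega, show l + j + 1 - 1 - l = j by omega, markov,
      mulVec_mulVec, Matrix.mul_assoc]
  · simp [markov]

/-- With `û(w) = ∑ w^k u_k`, the average of `û^* Φ û` over `|w| = r` has nonnegative real part.
Expanding it leaves only the terms with `l ≤ k`, and these assemble to the convolution of the Markov
parameters with `u`, that is, to the output at time `k`. -/
theorem toeplitz_nonneg_of_radius (A : Matrix ν ν ℂ) (B : Matrix ν ι ℂ) (C : Matrix ι ν ℂ)
    (D : Matrix ι ι ℂ) (Φ : ℂ → Matrix ι ι ℂ)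
    (hd : ∀ i j, DifferentiableOn ℂ (fun w => Φ w i j) (ball 0 1))
    (hpos : ∀ w ∈ ball (0 : ℂ) 1, w ≠ 0 → ∀ u, 0 ≤ (star u ⬝ᵥ (Φ w *ᵥ u)).re)
    (hnear : ∀ᶠ w in 𝓝[≠] 0, Φ w = D + w • (C * (1 - w • A)⁻¹ * B))
    (u : ℕ → ι → ℂ) (T : ℕ) {r : ℝ} (hr : 0 < r) (hr1 : r < 1) :
    0 ≤ ∑ k ∈ Finset.range T,
      r ^ (2 * k) * (star (u k) ⬝ᵥ (C *ᵥ traj A B u 0 k + D *ᵥ u k)).re := by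
  have hentry : ∀ i j, ∀ᶠ w in 𝓝[≠] 0, Φ w i j =
      D i j + w * (C i ⬝ᵥ ((1 - w • A)⁻¹ *ᵥ (fun p => B p j))) := fun i j => by
    filter_upwards [hnear] with w hw
    rw [hw, Matrix.add_apply, Matrix.smul_apply, Matrix.mul_assoc, smul_eq_mul]
    rfl
  have hcont : ∀ i j (k l : ℕ), CircleIntegrable
      (fun w => star w ^ k * w ^ l * Φ w i j) 0 r := fun i j k l => by
    refine ContinuousOn.circleIntegrable' (ContinuousOn.mul ?_ ?_)
    · fun_prop
    · rw [abs_of_pos hr]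
      exact continuousOn_sphere_of_differentiableOn hr1 (hd i j)
  let H : ℂ → ℂ := fun w => ∑ k ∈ Finset.range T, ∑ l ∈ Finset.range T, ∑ i, ∑ j,
    (star (u k i) * u l j) • (star w ^ k * w ^ l * Φ w i j)
  have hH : ∀ w, H w = star (∑ k ∈ Finset.range T, w ^ k • u k) ⬝ᵥ
      (Φ w *ᵥ ∑ k ∈ Finset.range T, w ^ k • u k) := fun w => by
    simp only [H, star_sum, mulVec_sum, sum_dotProduct, dotProduct_sum]
    rw [Finset.sum_comm]
    refine Finset.sum_congr rfl fun l _ => Finset.sum_congr rfl fun k _ => ?_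
    simp only [dotProduct, mulVec, Finset.mul_sum, smul_eq_mul, Pi.star_apply, Pi.smul_apply,
      star_mul', star_pow]
    refine Finset.sum_congr rfl fun i _ => Finset.sum_congr rfl fun j _ => ?_
    ring
  have hint1 : ∀ k l i, CircleIntegrable
      (fun w => ∑ j, (star (u k i) * u l j) • (star w ^ k * w ^ l * Φ w i j)) 0 r :=
    fun k l i => CircleIntegrable.fun_sum _ fun j _ => (hcont i j k l).const_smul
  have hint2 : ∀ k l, CircleIntegrable
      (fun w => ∑ i, ∑ j, (star (u k i) * u l j) • (star w ^ k * w ^ l * Φ w i j)) 0 r :=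
    fun k l => CircleIntegrable.fun_sum _ fun i _ => hint1 k l i
  have hint3 : ∀ k, CircleIntegrable (fun w => ∑ l ∈ Finset.range T,
      ∑ i, ∑ j, (star (u k i) * u l j) • (star w ^ k * w ^ l * Φ w i j)) 0 r :=
    fun k => CircleIntegrable.fun_sum _ fun l _ => hint2 k l
  have hintH : CircleIntegrable H 0 r := CircleIntegrable.fun_sum _ fun k _ => hint3 k
  have havg : circleAverage H 0 r = ∑ k ∈ Finset.range T,
      (r : ℂ) ^ (2 * k) * (star (u k) ⬝ᵥ (C *ᵥ traj A B u 0 k + D *ᵥ u k)) := by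
    simp only [H]
    rw [circleAverage_fun_sum fun k _ => hint3 k]
    refine Finset.sum_congr rfl fun k hk => ?_
    rw [Finset.mem_range] at hk
    rw [circleAverage_fun_sum fun l _ => hint2 k l, output_eq_sum_markov, dotProduct_sum,
      Finset.mul_sum]
    have hsub : Finset.range (k + 1) = (Finset.range T).filter (· ≤ k) := by
      ext l; simp only [Finset.mem_range, Finset.mem_filter]; omega
    rw [hsub, Finset.sum_filter]
    refine Finset.sum_congr rfl fun l _ => ?_
    rw [circleAverage_fun_sum fun i _ => hint1 k l i]
    have : ∀ i, circleAverage
        (fun w => ∑ j, (star (u k i) * u l j) • (star w ^ k * w ^ l * Φ w i j)) 0 r =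
        ∑ j, (star (u k i) * u l j) •
          if l ≤ k then (r : ℂ) ^ (2 * k) * markov A B C D (k - l) i j else 0 := fun i => by
      rw [circleAverage_fun_sum (f := fun j w =>
        (star (u k i) * u l j) • (star w ^ k * w ^ l * Φ w i j))
        fun j _ => (hcont i j k l).const_smul]
      refine Finset.sum_congr rfl fun j _ => ?_
      rw [circleAverage_fun_smul, circleAverage_conj_pow_mul_pow_mul A (fun p => B p j) hr hr1 k l
        (fun w => Φ w i j) (C i) (D i j) (hd i j) (hentry i j), scalarMarkov_eq_markov]
    simp only [this]
    split_ifs with hlk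
    · simp only [dotProduct, mulVec, Finset.mul_sum, smul_eq_mul, Pi.star_apply]
      refine Finset.sum_congr rfl fun i _ => Finset.sum_congr rfl fun j _ => ?_
      ring
    · simp
  have hre : 0 ≤ (circleAverage H 0 r).re := by
    have h1 := Complex.reCLM.circleAverage_comp_comm hintH
    have h2 : 0 ≤ circleAverage (Complex.reCLM ∘ H) 0 r := by
      refine circleAverage_nonneg_of_nonneg fun w hw => ?_
      simp only [Function.comp_apply, Complex.reCLM_apply, hH]
      rw [mem_sphere_zero_iff_norm, abs_of_pos hr] at hw
      refine hpos w ?_ ?_ _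
      · rw [mem_ball_zero_iff]; linarith
      · exact norm_pos_iff.1 (hw ▸ hr)
    rw [h1] at h2
    simpa using h2
  rw [havg, Complex.re_sum] at hre
  refine hre.trans_eq (Finset.sum_congr rfl fun k _ => ?_)
  rw [← Complex.ofReal_pow, Complex.re_ofReal_mul]

/-- Passivity along finite trajectories started at rest. -/
theorem toeplitz_nonneg (A : Matrix ν ν ℂ) (B : Matrix ν ι ℂ) (C : Matrix ι ν ℂ)
    (D : Matrix ι ι ℂ) (Φ : ℂ → Matrix ι ι ℂ)
    (hd : ∀ i j, DifferentiableOn ℂ (fun w => Φ w i j) (ball 0 1))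
    (hpos : ∀ w ∈ ball (0 : ℂ) 1, w ≠ 0 → ∀ u, 0 ≤ (star u ⬝ᵥ (Φ w *ᵥ u)).re)
    (hnear : ∀ᶠ w in 𝓝[≠] 0, Φ w = D + w • (C * (1 - w • A)⁻¹ * B))
    (u : ℕ → ι → ℂ) (T : ℕ) :
    0 ≤ ∑ k ∈ Finset.range T, (star (u k) ⬝ᵥ (C *ᵥ traj A B u 0 k + D *ᵥ u k)).re := by
  have hc : ContinuousAt (fun r : ℝ => ∑ k ∈ Finset.range T,
      r ^ (2 * k) * (star (u k) ⬝ᵥ (C *ᵥ traj A B u 0 k + D *ᵥ u k)).re) 1 := by fun_prop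
  have ht := hc.tendsto.mono_left (nhdsWithin_le_nhds (s := Set.Iio 1))
  simp only [one_pow, one_mul] at ht
  refine ge_of_tendsto ht ?_
  filter_upwards [Ioo_mem_nhdsLT (zero_lt_one' ℝ)] with r hr
  exact toeplitz_nonneg_of_radius A B C D Φ hd hpos hnear u T hr.1 hr.2

end Moments

/-! ### From the parallelogram law to a positive definite matrix -/

section JordanVonNeumann

/-- A definite convex function that is homogeneous of degree two and satisfies the parallelogram
law is the quadratic form of a Hermitian form. -/
theorem exists_sesquilinear_of_parallelogram {E : Type*} [AddCommGroup E] [Module ℂ E]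
    (f : E → ℝ) (hnonneg : ∀ x, 0 ≤ f x) (hsmul : ∀ (c : ℂ) x, f (c • x) = ‖c‖ ^ 2 * f x)
    (hpar : ∀ x y, f (x + y) + f (x - y) = 2 * f x + 2 * f y)
    (hconv : ∀ (a b : ℝ), 0 ≤ a → 0 ≤ b → a + b = 1 → ∀ x y,
      f ((a : ℂ) • x + (b : ℂ) • y) ≤ a * f x + b * f y)
    (hdef : ∀ x, f x = 0 → x = 0) :
    ∃ s : E →ₗ⋆[ℂ] E →ₗ[ℂ] ℂ, (∀ x y, star (s x y) = s y x) ∧ ∀ x, s x x = f x := by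
  have hzero : f 0 = 0 := by simpa using hsmul 0 0
  let N : AddGroupNorm E :=
    { toFun := fun x => √(f x)
      map_zero' := by simp [hzero]
      neg' := fun x => by
        have := hsmul (-1) x
        simp only [neg_smul, one_smul, norm_neg, norm_one, one_pow, one_mul] at this
        rw [this]
      add_le' := fun x y => by
        rcases eq_or_ne x 0 with rfl | hx
        · simp [hzero]
        rcases eq_or_ne y 0 with rfl | hy
        · simp [hzero]
        have hfx : 0 < f x := (hnonneg x).lt_of_ne fun h => hx (hdef x h.symm)
        have hfy : 0 < f y := (hnonneg y).lt_of_ne fun h => hy (hdef y h.symm)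
        have hp : 0 < √(f x) := Real.sqrt_pos.2 hfx
        have hq : 0 < √(f y) := Real.sqrt_pos.2 hfy
        set p := √(f x) with hpdef
        set q := √(f y) with hqdef
        have hp2 : f x = p ^ 2 := (Real.sq_sqrt hfx.le).symm
        have hq2 : f y = q ^ 2 := (Real.sq_sqrt hfy.le).symm
        have hpq : 0 < p + q := by positivity
        -- Both rescaled vectors have `f`-value `(p + q)²`, and `x + y` is their convex combination
        -- with these weights. Hence `f (x + y) ≤ (p + q)²`, the triangle inequality for `√f`.
        have key := hconv (p / (p + q)) (q / (p + q)) (by positivity) (by positivity)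
          (by field_simp) ((((p + q) / p : ℝ) : ℂ) • x) ((((p + q) / q : ℝ) : ℂ) • y)
        rw [smul_smul, smul_smul, ← Complex.ofReal_mul, ← Complex.ofReal_mul,
          div_mul_div_cancel₀ hpq.ne', div_mul_div_cancel₀ hpq.ne', div_self hp.ne',
          div_self hq.ne', Complex.ofReal_one, one_smul, one_smul, hsmul, hsmul,
          Complex.norm_real, Complex.norm_real, Real.norm_eq_abs, Real.norm_eq_abs, sq_abs, sq_abs,
          hp2, hq2] at key
        refine Real.sqrt_le_iff.2 ⟨hpq.le, key.trans_eq ?_⟩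
        field_simp
      eq_zero_of_map_eq_zero' := fun x hx => hdef x ((Real.sqrt_eq_zero (hnonneg x)).1 hx) }
  let _ : NormedAddCommGroup E := N.toNormedAddCommGroup
  have hnorm : ∀ x : E, ‖x‖ = √(f x) := fun _ => rfl
  let _ : NormedSpace ℂ E :=
    { norm_smul_le := fun c x => by
        rw [hnorm, hnorm, hsmul, Real.sqrt_mul (sq_nonneg _), Real.sqrt_sq (norm_nonneg _)] }
  let _ : InnerProductSpace ℂ E := InnerProductSpace.ofNorm ℂ fun x y => by
    simp only [hnorm, Real.mul_self_sqrt (hnonneg _)]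
    linarith [hpar x y]
  refine ⟨innerₛₗ ℂ, fun x y => inner_conj_symm y x, fun x => ?_⟩
  rw [innerₛₗ_apply_apply, inner_self_eq_norm_sq_to_K, hnorm]
  norm_cast
  exact congrArg _ (Real.sq_sqrt (hnonneg x))

variable {ν : Type*} [Fintype ν] [DecidableEq ν]

theorem exists_posDef_of_parallelogram (f : (ν → ℂ) → ℝ) (hnonneg : ∀ x, 0 ≤ f x)
    (hsmul : ∀ (c : ℂ) x, f (c • x) = ‖c‖ ^ 2 * f x)
    (hpar : ∀ x y, f (x + y) + f (x - y) = 2 * f x + 2 * f y)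
    (hconv : ∀ (a b : ℝ), 0 ≤ a → 0 ≤ b → a + b = 1 → ∀ x y,
      f ((a : ℂ) • x + (b : ℂ) • y) ≤ a * f x + b * f y)
    (hdef : ∀ x, f x = 0 → x = 0) :
    ∃ P : Matrix ν ν ℂ, P.PosDef ∧ ∀ x, star x ⬝ᵥ (P *ᵥ x) = f x := by
  obtain ⟨s, hsymm, hs⟩ := exists_sesquilinear_of_parallelogram f hnonneg hsmul hpar hconv hdef
  let P : Matrix ν ν ℂ := .of fun i j => s (Pi.single i 1) (Pi.single j 1)
  have hP : ∀ x, star x ⬝ᵥ (P *ᵥ x) = f x := fun x => by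
    have hx : x = ∑ i, x i • (Pi.single i (1 : ℂ) : ν → ℂ) := by
      simpa [← Pi.single_smul] using pi_eq_sum_univ' x
    rw [← hs]
    conv_rhs => rw [hx]
    simp only [map_sum, LinearMap.sum_apply, LinearMap.map_smulₛₗ, LinearMap.smul_apply,
      dotProduct, mulVec, Finset.mul_sum, smul_eq_mul, RingHom.id_apply, Pi.star_apply, P,
      Matrix.of_apply]
    rw [Finset.sum_comm]
    refine Finset.sum_congr rfl fun i _ => Finset.sum_congr rfl fun j _ => ?_
    simp only [starRingEnd_apply]
    ring
  refine ⟨P, Matrix.PosDef.of_dotProduct_mulVec_pos ?_ fun x hx => ?_, hP⟩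
  · ext i j
    exact hsymm _ _
  · rw [hP]
    exact_mod_cast (hnonneg x).lt_of_ne fun h => hx (hdef x h.symm)

end JordanVonNeumann

/-! ### Available storage of a passive discrete-time system -/

section Storage

variable {ν ι : Type*} [Fintype ν] [Fintype ι]

/-- Every `A`-invariant subspace containing the range of `B` is the whole space. -/
def IsControllable (A : Matrix ν ν ℂ) (B : Matrix ν ι ℂ) : Prop :=
  ∀ V : Submodule ℂ (ν → ℂ), (∀ x ∈ V, A *ᵥ x ∈ V) → (∀ u, B *ᵥ u ∈ V) → V = ⊤

/-- Every `A`-invariant subspace of the kernel of `C` is trivial. -/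
def IsObservable {κ : Type*} (A : Matrix ν ν ℂ) (C : Matrix κ ν ℂ) : Prop :=
  ∀ V : Submodule ℂ (ν → ℂ), (∀ x ∈ V, A *ᵥ x ∈ V) → (∀ x ∈ V, C *ᵥ x = 0) → V = ⊥

/-- The energy extracted from the system in `T` steps, started at `x` and driven by `u`, for the
supply rate `2 Re u^* y`. -/
def extracted (A : Matrix ν ν ℂ) (B : Matrix ν ι ℂ) (C : Matrix ι ν ℂ) (D : Matrix ι ι ℂ) :
    ℕ → (ℕ → ι → ℂ) → (ν → ℂ) → ℝ
  | 0, _, _ => 0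
  | T + 1, u, x => extracted A B C D T (fun k => u (k + 1)) (A *ᵥ x + B *ᵥ u 0) -
      2 * (star (u 0) ⬝ᵥ (C *ᵥ x + D *ᵥ u 0)).re

variable (A : Matrix ν ν ℂ) (B : Matrix ν ι ℂ) (C : Matrix ι ν ℂ) (D : Matrix ι ι ℂ)

theorem traj_succ_eq (u : ℕ → ι → ℂ) (x : ν → ℂ) (k : ℕ) :
    traj A B u x (k + 1) = traj A B (fun k => u (k + 1)) (A *ᵥ x + B *ᵥ u 0) k := by
  induction k with
  | zero => rfl
  | succ k ih => rw [traj, ih, traj]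

theorem extracted_eq_sum (T : ℕ) (u : ℕ → ι → ℂ) (x : ν → ℂ) :
    extracted A B C D T u x =
      -(2 * ∑ k ∈ Finset.range T, (star (u k) ⬝ᵥ (C *ᵥ traj A B u x k + D *ᵥ u k)).re) := by
  induction T generalizing u x with
  | zero => simp [extracted]
  | succ T ih =>
    rw [extracted, ih, Finset.sum_range_succ']
    simp only [traj_succ_eq]
    rw [traj]
    ring

theorem extracted_cons (T : ℕ) (u : ι → ℂ) (v : ℕ → ι → ℂ) (x : ν → ℂ) :
    extracted A B C D (T + 1) (fun k => Nat.casesOn k u v) x =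
      extracted A B C D T v (A *ᵥ x + B *ᵥ u) - 2 * (star u ⬝ᵥ (C *ᵥ x + D *ᵥ u)).re :=
  rfl

theorem extracted_zero_input (T : ℕ) (x : ν → ℂ) :
    extracted A B C D T (fun _ => 0) x = 0 := by
  induction T generalizing x with
  | zero => rfl
  | succ T ih => simp [extracted, ih]

/-- A zero input supplies no energy, so padding with zeros costs nothing. This lets two inputs with
different horizons be compared on a common one. -/
theorem extracted_truncate {T S : ℕ} (h : T ≤ S) (u : ℕ → ι → ℂ) (x : ν → ℂ) :
    extracted A B C D S (fun k => if k < T then u k else 0) x = extracted A B C D T u x := by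
  induction T generalizing S u x with
  | zero => simpa [extracted] using extracted_zero_input A B C D S x
  | succ T ih =>
    obtain ⟨S, rfl⟩ : ∃ R, S = R + 1 := ⟨S - 1, by omega⟩
    rw [extracted, extracted]
    simp only [Nat.zero_lt_succ, if_true, Nat.add_lt_add_iff_right]
    rw [ih (by omega)]

theorem extracted_parallelogram (T : ℕ) (u v : ℕ → ι → ℂ) (x y : ν → ℂ) :
    extracted A B C D T (fun k => u k + v k) (x + y) +
      extracted A B C D T (fun k => u k - v k) (x - y) =
      2 * extracted A B C D T u x + 2 * extracted A B C D T v y := by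
  induction T generalizing u v x y with
  | zero => simp [extracted]
  | succ T ih =>
    simp only [extracted]
    have h := ih (fun k => u (k + 1)) (fun k => v (k + 1)) (A *ᵥ x + B *ᵥ u 0) (A *ᵥ y + B *ᵥ v 0)
    rw [show A *ᵥ x + B *ᵥ u 0 + (A *ᵥ y + B *ᵥ v 0) = A *ᵥ (x + y) + B *ᵥ (u 0 + v 0) by
        rw [mulVec_add, mulVec_add]; abel,
      show A *ᵥ x + B *ᵥ u 0 - (A *ᵥ y + B *ᵥ v 0) = A *ᵥ (x - y) + B *ᵥ (u 0 - v 0) by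
        rw [mulVec_sub, mulVec_sub]; abel] at h
    simp only [mulVec_add, mulVec_sub, star_add, star_sub, add_dotProduct, sub_dotProduct,
      dotProduct_add, dotProduct_sub, Complex.add_re, Complex.sub_re] at h ⊢
    linarith

theorem extracted_smul (T : ℕ) (c : ℂ) (u : ℕ → ι → ℂ) (x : ν → ℂ) :
    extracted A B C D T (fun k => c • u k) (c • x) = ‖c‖ ^ 2 * extracted A B C D T u x := by
  induction T generalizing u x with
  | zero => simp [extracted]
  | succ T ih =>
    simp only [extracted]
    rw [mulVec_smul, mulVec_smul, mulVec_smul, mulVec_smul, ← smul_add, ← smul_add, star_smul,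
      smul_dotProduct, dotProduct_smul, ih (fun k => u (k + 1)), smul_smul, smul_eq_mul,
      show star c * c = ((‖c‖ ^ 2 : ℝ) : ℂ) by simpa using Complex.conj_mul' c,
      Complex.re_ofReal_mul]
    ring

/-- For a fixed input the state depends affinely on `x`, and the supply `2 Re u^* y` is affine in
the state. A supremum over inputs is therefore convex in `x`. -/
theorem extracted_affine (T : ℕ) (u : ℕ → ι → ℂ) {a b : ℝ} (hab : a + b = 1) (x y : ν → ℂ) :
    extracted A B C D T u ((a : ℂ) • x + (b : ℂ) • y) =
      a * extracted A B C D T u x + b * extracted A B C D T u y := by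
  induction T generalizing u x y with
  | zero => simp [extracted]
  | succ T ih =>
    have hab' : (a : ℂ) + b = 1 := by exact_mod_cast hab
    have hstate : A *ᵥ ((a : ℂ) • x + (b : ℂ) • y) + B *ᵥ u 0 =
        (a : ℂ) • (A *ᵥ x + B *ᵥ u 0) + (b : ℂ) • (A *ᵥ y + B *ᵥ u 0) := by
      conv_lhs => rw [← one_smul ℂ (B *ᵥ u 0), ← hab', add_smul]
      simp only [mulVec_add, mulVec_smul, smul_add]
      abel
    have hout : C *ᵥ ((a : ℂ) • x + (b : ℂ) • y) + D *ᵥ u 0 =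
        (a : ℂ) • (C *ᵥ x + D *ᵥ u 0) + (b : ℂ) • (C *ᵥ y + D *ᵥ u 0) := by
      conv_lhs => rw [← one_smul ℂ (D *ᵥ u 0), ← hab', add_smul]
      simp only [mulVec_add, mulVec_smul, smul_add]
      abel
    simp only [extracted]
    rw [hstate, hout, ih, dotProduct_add, dotProduct_smul, dotProduct_smul, Complex.add_re,
      smul_eq_mul, smul_eq_mul, Complex.re_ofReal_mul, Complex.re_ofReal_mul]
    ring

variable {A B C D}

/-- The states from which bounded energy can be extracted form a subspace: sums are handled by
affinity, through `x + y = ½ (2x) + ½ (2y)`, and multiples by homogeneity. Prepending one input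
shows that it is stable under every step of the system, so controllability makes it everything. -/
theorem extracted_bounded (hctrl : IsControllable A B)
    (hrest : ∀ T u, extracted A B C D T u 0 ≤ 0) (x : ν → ℂ) :
    ∃ M, ∀ T u, extracted A B C D T u x ≤ M := by
  have hsmul : ∀ (c : ℂ) (x : ν → ℂ), (∃ M, ∀ T u, extracted A B C D T u x ≤ M) →
      ∃ M, ∀ T u, extracted A B C D T u (c • x) ≤ M := by
    rintro c x ⟨M, hM⟩
    rcases eq_or_ne c 0 with rfl | hc
    · exact ⟨0, fun T u => by simpa using hrest T u⟩
    · refine ⟨‖c‖ ^ 2 * M, fun T u => ?_⟩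
      have h := extracted_smul A B C D T c (fun k => c⁻¹ • u k) x
      simp only [smul_smul, mul_inv_cancel₀ hc, one_smul] at h
      rw [h]
      exact mul_le_mul_of_nonneg_left (hM _ _) (by positivity)
  let V : Submodule ℂ (ν → ℂ) :=
    { carrier := {x | ∃ M, ∀ T u, extracted A B C D T u x ≤ M}
      zero_mem' := ⟨0, hrest⟩
      smul_mem' := fun c x hx => hsmul c x hx
      add_mem' := fun {x y} hx hy => by
        obtain ⟨M, hM⟩ := hsmul 2 x hx
        obtain ⟨N, hN⟩ := hsmul 2 y hy
        refine ⟨1 / 2 * M + 1 / 2 * N, fun T u => ?_⟩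
        have h := extracted_affine A B C D T u (a := 1 / 2) (b := 1 / 2) (by norm_num)
          ((2 : ℂ) • x) ((2 : ℂ) • y)
        rw [smul_smul, smul_smul, show ((1 / 2 : ℝ) : ℂ) * 2 = 1 by push_cast; norm_num,
          one_smul, one_smul] at h
        rw [h]
        linarith [hM T u, hN T u] }
  have hstep : ∀ x ∈ V, ∀ u : ι → ℂ, A *ᵥ x + B *ᵥ u ∈ V := by
    rintro x ⟨M, hM⟩ u
    refine ⟨M + 2 * (star u ⬝ᵥ (C *ᵥ x + D *ᵥ u)).re, fun T v => ?_⟩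
    have h := hM (T + 1) (fun k => Nat.casesOn k u v)
    rw [extracted_cons] at h
    linarith
  have htop : V = ⊤ := by
    refine hctrl V (fun x hx => ?_) fun u => ?_
    · simpa using hstep x hx 0
    · simpa using hstep 0 V.zero_mem u
  exact (htop ▸ Submodule.mem_top : x ∈ V)

/-- A controllable, observable discrete-time system that is passive along trajectories started at
rest has a positive definite quadratic storage function. -/
theorem exists_storage [DecidableEq ν] (hctrl : IsControllable A B) (hobs : IsObservable A C)
    (hrest : ∀ T u, extracted A B C D T u 0 ≤ 0) :
    ∃ P : Matrix ν ν ℂ, P.PosDef ∧ ∀ x u,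
      (star (A *ᵥ x + B *ᵥ u) ⬝ᵥ (P *ᵥ (A *ᵥ x + B *ᵥ u))).re ≤
        (star x ⬝ᵥ (P *ᵥ x)).re + 2 * (star u ⬝ᵥ (C *ᵥ x + D *ᵥ u)).re := by
  -- The available storage. The horizon `T = 0` is allowed, which makes it nonnegative.
  let f : (ν → ℂ) → ℝ := fun x => ⨆ p : ℕ × (ℕ → ι → ℂ), extracted A B C D p.1 p.2 x
  have hle : ∀ T u x, extracted A B C D T u x ≤ f x := fun T u x => by
    obtain ⟨M, hM⟩ := extracted_bounded hctrl hrest x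
    exact le_ciSup (f := fun p : ℕ × (ℕ → ι → ℂ) => extracted A B C D p.1 p.2 x)
      ⟨M, by rintro _ ⟨p, rfl⟩; exact hM _ _⟩ (T, u)
  have hsup : ∀ x M, (∀ T u, extracted A B C D T u x ≤ M) → f x ≤ M := fun x M h =>
    ciSup_le fun p => h p.1 p.2
  have hnonneg : ∀ x, 0 ≤ f x := fun x => hle 0 (fun _ => 0) x
  have hdiss : ∀ x u, f (A *ᵥ x + B *ᵥ u) ≤ f x + 2 * (star u ⬝ᵥ (C *ᵥ x + D *ᵥ u)).re :=
    fun x u => hsup _ _ fun T v => by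
      have h := hle (T + 1) (fun k => Nat.casesOn k u v) x
      rw [extracted_cons] at h
      linarith
  have hzero : f 0 = 0 := le_antisymm (hsup 0 0 hrest) (hnonneg 0)
  have hsmul_le : ∀ (c : ℂ) x, ‖c‖ ^ 2 * f x ≤ f (c • x) := fun c x => by
    rcases eq_or_ne c 0 with rfl | hc
    · simpa using hnonneg 0
    · have hc2 : 0 < ‖c‖ ^ 2 := by positivity
      rw [← le_div_iff₀' hc2]
      refine hsup _ _ fun T u => ?_
      rw [le_div_iff₀' hc2, ← extracted_smul]
      exact hle _ _ _
  have hsmul : ∀ (c : ℂ) x, f (c • x) = ‖c‖ ^ 2 * f x := fun c x => by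
    refine le_antisymm ?_ (hsmul_le c x)
    rcases eq_or_ne c 0 with rfl | hc
    · simp [hzero]
    · have h := hsmul_le c⁻¹ (c • x)
      have hc2 : 0 < ‖c‖ ^ 2 := by positivity
      rw [smul_smul, inv_mul_cancel₀ hc, one_smul, norm_inv, inv_pow, inv_mul_le_iff₀ hc2] at h
      exact h
  have hpar_le : ∀ x y, 2 * f x + 2 * f y ≤ f (x + y) + f (x - y) := fun x y => by
    have h1 : ∀ T u S v, 2 * extracted A B C D T u x + 2 * extracted A B C D S v y ≤
        f (x + y) + f (x - y) := fun T u S v => by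
      rw [← extracted_truncate A B C D (le_max_left T S), ← extracted_truncate A B C D
        (le_max_right T S), ← extracted_parallelogram]
      exact add_le_add (hle _ _ _) (hle _ _ _)
    have h2 : ∀ T u, 2 * extracted A B C D T u x + 2 * f y ≤ f (x + y) + f (x - y) :=
      fun T u => by
        have := hsup y ((f (x + y) + f (x - y) - 2 * extracted A B C D T u x) / 2)
          fun S v => by linarith [h1 T u S v]
        linarith
    have := hsup x ((f (x + y) + f (x - y) - 2 * f y) / 2) fun T u => by linarith [h2 T u]
    linarith
  have hpar : ∀ x y, f (x + y) + f (x - y) = 2 * f x + 2 * f y := fun x y => by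
    refine le_antisymm ?_ (hpar_le x y)
    -- The reverse inequality is the first one applied to `x + y` and `x - y`, by homogeneity.
    have h := hpar_le (x + y) (x - y)
    rw [show x + y + (x - y) = (2 : ℂ) • x by rw [two_smul]; abel,
      show x + y - (x - y) = (2 : ℂ) • y by rw [two_smul]; abel, hsmul, hsmul] at h
    norm_num at h
    linarith
  have hconv : ∀ (a b : ℝ), 0 ≤ a → 0 ≤ b → a + b = 1 → ∀ x y,
      f ((a : ℂ) • x + (b : ℂ) • y) ≤ a * f x + b * f y := fun a b ha hb hab x y =>
    hsup _ _ fun T u => by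
      rw [extracted_affine A B C D T u hab]
      exact add_le_add (mul_le_mul_of_nonneg_left (hle _ _ _) ha)
        (mul_le_mul_of_nonneg_left (hle _ _ _) hb)
  have hker : ∀ x, f x = 0 → C *ᵥ x = 0 := fun x hx => by
    by_contra hCx
    set y := C *ᵥ x with hy
    have hypos : 0 < (star y ⬝ᵥ y).re :=
      (Complex.pos_iff.1 (dotProduct_star_self_pos_iff.2 hCx)).1
    set d := (star y ⬝ᵥ (D *ᵥ y)).re with hd
    -- The input `-ε y` supplies `-2ε (|y|² - ε d)`. For small `ε` this is negative, so a state of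
    -- zero storage would move to one of negative storage.
    obtain ⟨ε, hε, hεd⟩ : ∃ ε : ℝ, 0 < ε ∧ ε * d < (star y ⬝ᵥ y).re := by
      refine ⟨(star y ⬝ᵥ y).re / (|d| + 1), by positivity, ?_⟩
      rw [div_mul_eq_mul_div, div_lt_iff₀ (by positivity)]
      exact mul_lt_mul_of_pos_left ((le_abs_self d).trans_lt (lt_add_one _)) hypos
    have h := hdiss x (((-ε : ℝ) : ℂ) • y)
    rw [hx, star_smul, smul_dotProduct, dotProduct_add, mulVec_smul D, dotProduct_smul, ← hy,
      show star ((-ε : ℝ) : ℂ) = ((-ε : ℝ) : ℂ) from Complex.conj_ofReal _, smul_eq_mul,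
      smul_eq_mul, Complex.re_ofReal_mul, Complex.add_re, Complex.re_ofReal_mul, ← hd] at h
    have h0 := hnonneg (A *ᵥ x + B *ᵥ (((-ε : ℝ) : ℂ) • y))
    nlinarith [mul_pos hε (sub_pos.2 hεd)]
  have hinv : ∀ x, f x = 0 → f (A *ᵥ x) = 0 := fun x hx => by
    refine le_antisymm ?_ (hnonneg _)
    simpa [hx] using hdiss x 0
  have hdef : ∀ x, f x = 0 → x = 0 := fun x hx => by
    -- The zero set of `f` is an `A`-invariant subspace of the kernel of `C`, hence trivial by
    -- observability.
    let V : Submodule ℂ (ν → ℂ) :=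
      { carrier := {x | f x = 0}
        zero_mem' := hzero
        smul_mem' := fun c x (hx : f x = 0) => by
          rw [Set.mem_ofPred_eq, hsmul, hx, mul_zero]
        add_mem' := fun {x y} (hx : f x = 0) (hy : f y = 0) => by
          have := hpar x y
          exact le_antisymm (by linarith [hnonneg (x - y)]) (hnonneg _) }
    have hbot : V = ⊥ := hobs V (fun x hx => hinv x hx) fun x hx => hker x hx
    have hxV : x ∈ V := hx
    rwa [hbot, Submodule.mem_bot] at hxV
  obtain ⟨P, hP, hPf⟩ := exists_posDef_of_parallelogram f hnonneg hsmul hpar hconv hdef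
  refine ⟨P, hP, fun x u => ?_⟩
  rw [hPf, hPf, Complex.ofReal_re, Complex.ofReal_re]
  exact hdiss x u

end Storage

/-! ### Positive real lemmas in discrete and continuous time -/

section Passivity

set_option linter.unusedSectionVars false

variable {ν ι : Type*} [Fintype ν] [DecidableEq ν] [Fintype ι]
  {A : Matrix ν ν ℂ} {B : Matrix ν ι ℂ} {C : Matrix ι ν ℂ} {D : Matrix ι ι ℂ}

theorem exists_storage_of_disc (hctrl : IsControllable A B) (hobs : IsObservable A C)
    (Φ : ℂ → Matrix ι ι ℂ)
    (hd : ∀ i j, DifferentiableOn ℂ (fun w => Φ w i j) (ball 0 1))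
    (hpos : ∀ w ∈ ball (0 : ℂ) 1, w ≠ 0 → ∀ u, 0 ≤ (star u ⬝ᵥ (Φ w *ᵥ u)).re)
    (hnear : ∀ᶠ w in 𝓝[≠] 0, Φ w = D + w • (C * (1 - w • A)⁻¹ * B)) :
    ∃ P : Matrix ν ν ℂ, P.PosDef ∧ ∀ x u,
      (star (A *ᵥ x + B *ᵥ u) ⬝ᵥ (P *ᵥ (A *ᵥ x + B *ᵥ u))).re ≤
        (star x ⬝ᵥ (P *ᵥ x)).re + 2 * (star u ⬝ᵥ (C *ᵥ x + D *ᵥ u)).re := by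
  refine exists_storage hctrl hobs fun T u => ?_
  rw [extracted_eq_sum]
  linarith [toeplitz_nonneg A B C D Φ hd hpos hnear u T]

theorem inv_smul_of_ne_zero {c : ℂ} (hc : c ≠ 0) {M : Matrix ν ν ℂ} (hM : IsUnit M.det) :
    (c • M)⁻¹ = c⁻¹ • M⁻¹ := by
  refine Matrix.inv_eq_left_inv ?_
  rw [smul_mul_smul_comm, inv_mul_cancel₀ hc, one_smul, Matrix.nonsing_inv_mul _ hM]

/-- Discrete-time positive real lemma. -/
theorem exists_storage_of_diskExterior (hctrl : IsControllable A B) (hobs : IsObservable A C)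
    (G : ℂ → Matrix ι ι ℂ) (hd : ∀ i j, DifferentiableOn ℂ (fun z => G z i j) diskExterior)
    (hpos : ∀ z ∈ diskExterior, ∀ u, 0 ≤ (star u ⬝ᵥ (G z *ᵥ u)).re)
    (hG : ∀ z ∈ diskExterior, IsUnit (z • 1 - A).det → G z = D + C * (z • 1 - A)⁻¹ * B) :
    ∃ P : Matrix ν ν ℂ, P.PosDef ∧ ∀ x u,
      (star (A *ᵥ x + B *ᵥ u) ⬝ᵥ (P *ᵥ (A *ᵥ x + B *ᵥ u))).re ≤
        (star x ⬝ᵥ (P *ᵥ x)).re + 2 * (star u ⬝ᵥ (C *ᵥ x + D *ᵥ u)).re := by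
  classical
  have hmem : ∀ w ∈ ball (0 : ℂ) 1, w ≠ 0 → w⁻¹ ∈ diskExterior := fun w hw hw0 => by
    rw [mem_ball_zero_iff] at hw
    change 1 < ‖w⁻¹‖
    rw [norm_inv]
    exact (one_lt_inv₀ (norm_pos_iff.2 hw0)).2 hw
  -- The substitution `z = 1/w` moves infinity to `0`, where the value is `D`.
  let Φ : ℂ → Matrix ι ι ℂ := fun w => if w = 0 then D else G w⁻¹
  have hΦ : ∀ w, w ≠ 0 → Φ w = G w⁻¹ := fun w hw => if_neg hw
  have hnear : ∀ᶠ w in 𝓝 0, Φ w = D + w • (C * (1 - w • A)⁻¹ * B) := by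
    filter_upwards [eventually_isUnit_det_one_sub_smul A, ball_mem_nhds (0 : ℂ) one_pos]
      with w hdet hw
    rcases eq_or_ne w 0 with rfl | hw0
    · simp [Φ]
    · have h1 : w⁻¹ • (1 : Matrix ν ν ℂ) - A = w⁻¹ • (1 - w • A) := by
        rw [smul_sub, smul_smul, inv_mul_cancel₀ hw0, one_smul]
      have h2 : IsUnit (w⁻¹ • (1 : Matrix ν ν ℂ) - A).det := by
        rw [h1, Matrix.det_smul]
        exact ((isUnit_iff_ne_zero.2 (inv_ne_zero hw0)).pow _).mul hdet
      rw [hΦ w hw0, hG _ (hmem w hw hw0) h2, h1, inv_smul_of_ne_zero (inv_ne_zero hw0) hdet,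
        inv_inv, Matrix.mul_smul, Matrix.smul_mul]
  refine exists_storage_of_disc hctrl hobs Φ (fun i j => ?_) (fun w hw hw0 u => ?_)
    (hnear.filter_mono nhdsWithin_le_nhds)
  -- The singularity at `0` is removable, since near `0` the function equals a continuous resolvent
  -- expression.
  · refine (Complex.differentiableOn_compl_singleton_and_continuousAt_iff
      (ball_mem_nhds (0 : ℂ) one_pos)).1 ⟨?_, ?_⟩
    · have h : DifferentiableOn ℂ (fun w => G w⁻¹ i j) (ball 0 1 \ {0}) :=
        (hd i j).comp (differentiableOn_inv.mono fun w hw => hw.2) fun w hw => hmem w hw.1 hw.2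
      exact h.congr fun w hw => by rw [hΦ w hw.2]
    · have h := continuousAt_inv_one_sub_smul A
      have h2 : Continuous fun p : ℂ × Matrix ν ν ℂ => (D + p.1 • (C * p.2 * B)) i j := by
        fun_prop
      have h3 : ContinuousAt (fun w : ℂ => (D + w • (C * (1 - w • A)⁻¹ * B)) i j) 0 :=
        h2.continuousAt.comp (continuousAt_id.prodMk h)
      exact h3.congr (hnear.mono fun w hw => by simp only [hw])
  · rw [hΦ w hw0]
    exact hpos _ (hmem w hw hw0) u

theorem re_dotProduct_mulVec_comm {P : Matrix ν ν ℂ} (hP : P.IsHermitian) (x y : ν → ℂ) :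
    (star x ⬝ᵥ (P *ᵥ y)).re = (star y ⬝ᵥ (P *ᵥ x)).re := by
  have h : star (star x ⬝ᵥ (P *ᵥ y)) = star y ⬝ᵥ (P *ᵥ x) := by
    rw [← star_dotProduct_star, star_star, star_mulVec, hP.eq, dotProduct_mulVec,
      dotProduct_comm]
  rw [← h]
  exact (Complex.conj_re _).symm

/-- `K⁻¹` is injective, so by dimension it maps `V` onto `V`. This transfers invariant subspaces
through the Cayley transformation. -/
theorem invariant_of_inv_invariant {K : Matrix ν ν ℂ} (hK : IsUnit K.det)
    {V : Submodule ℂ (ν → ℂ)} (hV : ∀ x ∈ V, K⁻¹ *ᵥ x ∈ V) : ∀ x ∈ V, K *ᵥ x ∈ V := by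
  have hinj : Function.Injective (K⁻¹).mulVecLin := fun x y h => by
    have h' : K *ᵥ (K⁻¹ *ᵥ x) = K *ᵥ (K⁻¹ *ᵥ y) := congrArg _ h
    simpa [mulVec_mulVec, Matrix.mul_nonsing_inv _ hK] using h'
  have hle : V.map (K⁻¹).mulVecLin ≤ V := by
    rintro _ ⟨x, hx, rfl⟩
    exact hV x hx
  have heq := Submodule.eq_of_le_of_finrank_eq hle 
    (Submodule.equivMapOfInjective _ hinj V).finrank_eq.symm
  intro x hx
  rw [← heq] at hx
  obtain ⟨y, hy, rfl⟩ := hx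
  simpa [mulVec_mulVec, Matrix.mul_nonsing_inv _ hK] using hy

/-- Supplies the Cayley parameter. The spectrum of `A` is not yet located, so a fixed `s` could be
an eigenvalue; there are only finitely many to avoid. -/
theorem exists_pos_isUnit_det (A : Matrix ν ν ℂ) :
    ∃ s : ℝ, 0 < s ∧ IsUnit ((s : ℂ) • (1 : Matrix ν ν ℂ) - A).det := by
  have hfin : ({z : ℂ | A.charpoly.IsRoot z}).Finite :=
    Polynomial.finite_setOfPred_isRoot A.charpoly_monic.ne_zero
  have hfin' : ((fun s : ℝ => (s : ℂ)) ⁻¹' {z : ℂ | A.charpoly.IsRoot z}).Finite :=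
    hfin.preimage Complex.ofReal_injective.injOn
  obtain ⟨s, hs, hs'⟩ := (Set.Ioi_infinite (0 : ℝ)).exists_notMem_finite hfin'
  refine ⟨s, hs, isUnit_iff_ne_zero.2 fun h => hs' ?_⟩
  change A.charpoly.eval (s : ℂ) = 0
  rw [Matrix.eval_charpoly, ← h, Matrix.scalar_apply, smul_one_eq_diagonal]

/-- Positive real lemma, reduced to discrete time by a Cayley transformation. -/
theorem exists_storage_of_rightHalfPlane (hctrl : IsControllable A B) (hobs : IsObservable A C)
    (G : ℂ → Matrix ι ι ℂ) (hd : ∀ i j, DifferentiableOn ℂ (fun z => G z i j) rightHalfPlane)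
    (hpos : ∀ z ∈ rightHalfPlane, ∀ u, 0 ≤ (star u ⬝ᵥ (G z *ᵥ u)).re)
    (hG : ∀ z ∈ rightHalfPlane, IsUnit (z • 1 - A).det → G z = D + C * (z • 1 - A)⁻¹ * B) :
    ∃ P : Matrix ν ν ℂ, P.PosDef ∧ ∀ x u,
      (star x ⬝ᵥ (P *ᵥ (A *ᵥ x + B *ᵥ u))).re ≤ (star u ⬝ᵥ (C *ᵥ x + D *ᵥ u)).re := by
  obtain ⟨s, hs, hdet⟩ := exists_pos_isUnit_det A
  set S : Matrix ν ν ℂ := (s : ℂ) • (1 : Matrix ν ν ℂ) - A with hS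
  have hSK : S * S⁻¹ = 1 := Matrix.mul_nonsing_inv _ hdet
  have hKS : S⁻¹ * S = 1 := Matrix.nonsing_inv_mul _ hdet
  have h2s : (2 * s : ℂ) ≠ 0 := by simpa using hs.ne'
  have hA : A = (s : ℂ) • (1 : Matrix ν ν ℂ) - S := by rw [hS, sub_sub_cancel]
  -- This is `(s + A) (s - A)⁻¹`, matching the map `σ w = s (1 - w) / (1 + w)` of the disc into the
  -- right half plane.
  let Ad : Matrix ν ν ℂ := (2 * s : ℂ) • S⁻¹ - 1
  let Bd : Matrix ν ι ℂ := (2 * s : ℂ) • (S⁻¹ * B)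
  have hAd : ∀ V : Submodule ℂ (ν → ℂ), (∀ x ∈ V, Ad *ᵥ x ∈ V) → ∀ x ∈ V, S *ᵥ x ∈ V := by
    intro V hV
    refine invariant_of_inv_invariant hdet fun x hx => ?_
    have h1 := V.smul_mem (2 * s : ℂ)⁻¹ (V.add_mem (hV x hx) hx)
    rwa [show Ad *ᵥ x + x = (2 * s : ℂ) • (S⁻¹ *ᵥ x) by
      rw [sub_mulVec, smul_mulVec, one_mulVec, sub_add_cancel], smul_smul, inv_mul_cancel₀ h2s,
      one_smul] at h1
  have hAV : ∀ V : Submodule ℂ (ν → ℂ), (∀ x ∈ V, Ad *ᵥ x ∈ V) → ∀ x ∈ V, A *ᵥ x ∈ V := by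
    intro V hV x hx
    rw [hA, sub_mulVec, smul_mulVec, one_mulVec]
    exact V.sub_mem (V.smul_mem _ hx) (hAd V hV x hx)
  have hctrl' : IsControllable Ad Bd := fun V hV hBV => by
    refine hctrl V (hAV V hV) fun u => ?_
    have h1 := hAd V hV _ (V.smul_mem (2 * s : ℂ)⁻¹ (hBV u))
    rwa [smul_mulVec, smul_smul, inv_mul_cancel₀ h2s, one_smul, mulVec_mulVec, ← Matrix.mul_assoc,
      hSK, Matrix.one_mul] at h1
  have hobs' : IsObservable Ad (C * S⁻¹) := fun V hV hCV => by
    refine hobs V (hAV V hV) fun x hx => ?_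
    have h1 := hCV _ (hAd V hV x hx)
    rwa [mulVec_mulVec, Matrix.mul_assoc, hKS, Matrix.mul_one] at h1
  let σ : ℂ → ℂ := fun w => s * (1 - w) / (1 + w)
  have hne : ∀ w ∈ ball (0 : ℂ) 1, 1 + w ≠ 0 := fun w hw h => by
    rw [mem_ball_zero_iff, eq_neg_of_add_eq_zero_right h] at hw
    simp at hw
  have hσ : ∀ w ∈ ball (0 : ℂ) 1, σ w ∈ rightHalfPlane := fun w hw => by
    have hw1 := hne w hw
    rw [mem_ball_zero_iff] at hw
    have hn : 0 < Complex.normSq (1 + w) := Complex.normSq_pos.2 hw1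
    have hnw : Complex.normSq w < 1 := by
      rw [Complex.normSq_eq_norm_sq]
      nlinarith [norm_nonneg w]
    change 0 < (σ w).re
    simp only [σ, Complex.div_re, ← add_div]
    refine div_pos ?_ hn
    rw [Complex.normSq_apply] at hnw
    simp
    nlinarith
  have hσd : DifferentiableOn ℂ σ (ball 0 1) := fun w hw => by
    refine DifferentiableAt.differentiableWithinAt ?_
    have := hne w hw
    simp only [σ]
    fun_prop (disch := assumption)
  -- The new feedthrough `D + C S⁻¹ B` is the value at `σ 0 = s`.
  obtain ⟨P, hP, hdiss⟩ := exists_storage_of_disc (D := D + C * S⁻¹ * B) hctrl' hobs'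
    (fun w => G (σ w)) (fun i j => (hd i j).comp hσd hσ) (fun w hw _ u => hpos _ (hσ w hw) u) (by
      refine Filter.Eventually.filter_mono nhdsWithin_le_nhds ?_
      filter_upwards [eventually_isUnit_det_one_sub_smul Ad, ball_mem_nhds (0 : ℂ) one_pos]
        with w hdetw hw
      have hw1 := hne w hw
      have h1 : σ w • (1 : Matrix ν ν ℂ) - A = (1 + w)⁻¹ • ((1 - w • Ad) * S) := by
        have hAdS : (1 - w • Ad) * S = (1 + w) • S - (2 * s * w : ℂ) • (1 : Matrix ν ν ℂ) := by
          simp only [Ad, sub_mul, smul_mul_assoc, hKS, one_mul, smul_sub, smul_smul, add_smul,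
            one_smul]
          rw [show w * (2 * s) = 2 * s * w by ring]
          abel
        have hσw : σ w = s - (1 + w)⁻¹ * (2 * s * w) := by
          simp only [σ]
          field_simp
          ring
        rw [hAdS, smul_sub, smul_smul, smul_smul, inv_mul_cancel₀ hw1, one_smul, hσw, hS, sub_smul]
        abel
      have hu : IsUnit ((1 - w • Ad) * S).det := by
        rw [Matrix.det_mul]
        exact hdetw.mul hdet
      have hu' : IsUnit (σ w • (1 : Matrix ν ν ℂ) - A).det := by
        rw [h1, Matrix.det_smul]
        exact ((isUnit_iff_ne_zero.2 (inv_ne_zero hw1)).pow _).mul hu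
      rw [hG _ (hσ w hw) hu', h1, inv_smul_of_ne_zero (inv_ne_zero hw1) hu, inv_inv,
        Matrix.mul_inv_rev]
      set M := (1 - w • Ad)⁻¹ with hM
      have hMM : M * (1 - w • Ad) = 1 := Matrix.nonsing_inv_mul _ hdetw
      have key : (1 + w) • M = 1 + (2 * s * w : ℂ) • (M * S⁻¹) := by
        rw [← hMM]
        simp only [Ad, mul_sub, mul_one, smul_sub, Matrix.mul_smul, smul_smul, add_smul, one_smul]
        rw [show w * (2 * s) = 2 * s * w by ring]
        abel
      rw [add_assoc]
      congr 1
      calc C * ((1 + w) • (S⁻¹ * M)) * B = C * S⁻¹ * ((1 + w) • M) * B := by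
            simp only [Matrix.mul_smul, Matrix.mul_assoc]
        _ = _ := by
            rw [key]
            simp only [Bd, Matrix.mul_add, Matrix.add_mul, Matrix.mul_smul, Matrix.smul_mul,
              Matrix.mul_one, Matrix.mul_assoc, smul_smul]
            rw [show w * (2 * s) = 2 * s * w by ring])
  -- With `x' = A x + B u`, the discrete system takes `s x - x'` to `s x + x'` with unchanged
  -- output. The two values of the form of `P` differ by `4 s Re x^* P x'`, bounded by `2 Re u^* y`;
  -- hence the factor `2 s`.
  refine ⟨(2 * s : ℝ) • P, hP.smul (by positivity), fun x u => ?_⟩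
  set x' := A *ᵥ x + B *ᵥ u with hx'
  have hx : S⁻¹ *ᵥ ((s : ℂ) • x - x') + S⁻¹ *ᵥ (B *ᵥ u) = x := by
    rw [← mulVec_add, hx', show (s : ℂ) • x - (A *ᵥ x + B *ᵥ u) + B *ᵥ u = S *ᵥ x by
      rw [hS, sub_mulVec, smul_mulVec, one_mulVec]; abel, mulVec_mulVec, hKS, one_mulVec]
  have hstate : Ad *ᵥ ((s : ℂ) • x - x') + Bd *ᵥ u = (s : ℂ) • x + x' := by
    calc Ad *ᵥ ((s : ℂ) • x - x') + Bd *ᵥ u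
        = (2 * s : ℂ) • (S⁻¹ *ᵥ ((s : ℂ) • x - x') + S⁻¹ *ᵥ (B *ᵥ u)) - ((s : ℂ) • x - x') := by
          simp only [Ad, Bd, sub_mulVec, smul_mulVec, one_mulVec, mulVec_mulVec, smul_add]
          abel
      _ = _ := by rw [hx, mul_smul, two_smul]; abel
  have hout : (C * S⁻¹) *ᵥ ((s : ℂ) • x - x') + (D + C * S⁻¹ * B) *ᵥ u = C *ᵥ x + D *ᵥ u := by
    conv_rhs => rw [← hx, mulVec_add]
    simp only [add_mulVec, mulVec_mulVec, Matrix.mul_assoc]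
    abel
  have h := hdiss ((s : ℂ) • x - x') u
  rw [hstate, hout] at h
  have hcomm := re_dotProduct_mulVec_comm hP.isHermitian x' x
  simp only [star_add, star_sub, mulVec_add, mulVec_sub, add_dotProduct, sub_dotProduct,
    dotProduct_add, dotProduct_sub, star_smul, smul_dotProduct, mulVec_smul, dotProduct_smul,
    Complex.add_re, Complex.sub_re, smul_eq_mul, Complex.re_ofReal_mul,
    show star (s : ℂ) = (s : ℂ) from Complex.conj_ofReal s, hcomm] at h
  rw [smul_mulVec, dotProduct_smul, Complex.smul_re, smul_eq_mul, dotProduct_add, Complex.add_re]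
  linarith

end Passivity

/-! ### Bounded real lemmas by dilation to the positive real case -/

section BoundedReal

set_option linter.unusedSectionVars false

variable {ν ι : Type*} [Fintype ν] [DecidableEq ν] [Fintype ι] [DecidableEq ι]
  {A : Matrix ν ν ℂ} {B : Matrix ν ι ℂ} {C : Matrix ι ν ℂ} {D : Matrix ι ι ℂ}

/-- The unipotent dilation of a square matrix: its Hermitian part is nonnegative if and only if
the matrix is a contraction. -/
def dilation (M : Matrix ι ι ℂ) : Matrix (ι ⊕ ι) (ι ⊕ ι) ℂ := fromBlocks 1 ((2 : ℂ) • M) 0 1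

/-- The input matrix of the dilated system. -/
def dilationB (B : Matrix ν ι ℂ) : Matrix ν (ι ⊕ ι) ℂ := fromCols 0 B

/-- The output matrix of the dilated system. -/
def dilationC (C : Matrix ι ν ℂ) : Matrix (ι ⊕ ι) ν ℂ := fromRows ((2 : ℂ) • C) 0

theorem dilation_transfer (K : Matrix ν ν ℂ) :
    dilation (D + C * K * B) = dilation D + dilationC C * K * dilationB B := by
  rw [dilation, dilation, dilationC, dilationB, fromRows_mul, fromRows_mul_fromCols,
    fromBlocks_add]
  simp [Matrix.smul_mul, smul_add]

theorem dilation_supply (x : ν → ℂ) (v u : ι → ℂ) :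
    star (Sum.elim v u) ⬝ᵥ (dilationC C *ᵥ x + dilation D *ᵥ Sum.elim v u) =
      star v ⬝ᵥ v + 2 * (star v ⬝ᵥ (C *ᵥ x + D *ᵥ u)) + star u ⬝ᵥ u := by
  have h : dilationC C *ᵥ x + dilation D *ᵥ Sum.elim v u =
      Sum.elim ((2 : ℂ) • (C *ᵥ x + D *ᵥ u) + v) u := by
    rw [dilationC, dilation, fromRows_mulVec, fromBlocks_mulVec]
    ext (i | i)
    · simp [smul_mulVec]
      ring
    · simp
  rw [h, show star (Sum.elim v u) = Sum.elim (star v) (star u) by ext (i | i) <;> rfl,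
    sumElim_dotProduct_sumElim, dotProduct_add, dotProduct_smul, smul_eq_mul]
  ring

theorem re_star_dotProduct_comm (v y : ι → ℂ) : (star v ⬝ᵥ y).re = (star y ⬝ᵥ v).re := by
  simpa using re_dotProduct_mulVec_comm (P := (1 : Matrix ι ι ℂ)) isHermitian_one v y

/-- Complete the square: the form at `(v, u)` is `|v + M u|² + |u|² - |M u|²`. -/
theorem dilation_re_nonneg {M : Matrix ι ι ℂ}
    (hM : ∀ u, (star (M *ᵥ u) ⬝ᵥ (M *ᵥ u)).re ≤ (star u ⬝ᵥ u).re) (w : ι ⊕ ι → ℂ) :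
    0 ≤ (star w ⬝ᵥ (dilation M *ᵥ w)).re := by
  obtain ⟨v, u, rfl⟩ : ∃ v u, w = Sum.elim v u :=
    ⟨w ∘ Sum.inl, w ∘ Sum.inr, (Sum.elim_comp_inl_inr w).symm⟩
  have h := dilation_supply (C := (0 : Matrix ι ι ℂ)) (D := M) 0 v u
  rw [mulVec_zero, zero_add, mulVec_zero, zero_add] at h
  have h1 : 0 ≤ (star (v + M *ᵥ u) ⬝ᵥ (v + M *ᵥ u)).re :=
    (Complex.nonneg_iff.1 (dotProduct_star_self_nonneg _)).1
  have h2 := re_star_dotProduct_comm (M *ᵥ u) v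
  have h3 := hM u
  rw [h]
  simp only [star_add, add_dotProduct, dotProduct_add, Complex.add_re, Complex.mul_re,
    Complex.re_ofNat, Complex.im_ofNat, zero_mul, sub_zero] at h1 ⊢
  linarith

theorem IsControllable.dilation (h : IsControllable A B) : IsControllable A (dilationB B) :=
  fun V hA hB => h V hA fun u => by
    simpa [dilationB, fromCols_mulVec] using hB (Sum.elim 0 u)

theorem IsObservable.dilation (h : IsObservable A C) : IsObservable A (dilationC C) :=
  fun V hA hC => h V hA fun x hx => by
    have h1 := hC x hx
    ext i
    have h2 := congrFun h1 (Sum.inl i)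
    simpa [dilationC, fromRows_mulVec, smul_mulVec] using h2

theorem dilationB_mulVec (v u : ι → ℂ) : dilationB B *ᵥ Sum.elim v u = B *ᵥ u := by
  simp [dilationB, fromCols_mulVec]

theorem differentiableOn_dilation {G : ℂ → Matrix ι ι ℂ} {Ω : Set ℂ}
    (hd : ∀ i j, DifferentiableOn ℂ (fun z => G z i j) Ω) (i j : ι ⊕ ι) :
    DifferentiableOn ℂ (fun z => KYP.dilation (G z) i j) Ω := by
  rcases i with i | i <;> rcases j with j | j
  · exact differentiableOn_const _
  · exact (hd i j).const_smul (2 : ℂ)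
  · exact differentiableOn_const _
  · exact differentiableOn_const _

/-- The extra input `v` does not enter the state equation, so it may be chosen freely; `v = -y`
minimizes the supply and produces the bounded real one. -/
theorem dilation_supply_neg_output (x : ν → ℂ) (u : ι → ℂ) :
    (star (Sum.elim (-(C *ᵥ x + D *ᵥ u)) u) ⬝ᵥ
      (dilationC C *ᵥ x + dilation D *ᵥ Sum.elim (-(C *ᵥ x + D *ᵥ u)) u)).re =
      (star u ⬝ᵥ u).re - (star (C *ᵥ x + D *ᵥ u) ⬝ᵥ (C *ᵥ x + D *ᵥ u)).re := by
  rw [dilation_supply]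
  simp only [star_neg, neg_dotProduct, dotProduct_neg, neg_neg, Complex.add_re, Complex.mul_re,
    Complex.re_ofNat, Complex.im_ofNat, zero_mul, sub_zero, Complex.neg_re]
  ring

/-- Discrete-time bounded real lemma. -/
theorem exists_storage_of_diskExterior_bounded (hctrl : IsControllable A B)
    (hobs : IsObservable A C) (G : ℂ → Matrix ι ι ℂ)
    (hd : ∀ i j, DifferentiableOn ℂ (fun z => G z i j) diskExterior)
    (hbd : ∀ z ∈ diskExterior, ∀ u, (star (G z *ᵥ u) ⬝ᵥ (G z *ᵥ u)).re ≤ (star u ⬝ᵥ u).re)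
    (hG : ∀ z ∈ diskExterior, IsUnit (z • 1 - A).det → G z = D + C * (z • 1 - A)⁻¹ * B) :
    ∃ P : Matrix ν ν ℂ, P.PosDef ∧ ∀ x u,
      (star (A *ᵥ x + B *ᵥ u) ⬝ᵥ (P *ᵥ (A *ᵥ x + B *ᵥ u))).re ≤
        (star x ⬝ᵥ (P *ᵥ x)).re + (star u ⬝ᵥ u).re -
          (star (C *ᵥ x + D *ᵥ u) ⬝ᵥ (C *ᵥ x + D *ᵥ u)).re := by
  obtain ⟨P, hP, h⟩ := exists_storage_of_diskExterior (D := dilation D) hctrl.dilation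
    hobs.dilation (fun z => dilation (G z)) (differentiableOn_dilation hd)
    (fun z hz w => dilation_re_nonneg (hbd z hz) w)
    (fun z hz hdet => by rw [hG z hz hdet, dilation_transfer])
  refine ⟨(2⁻¹ : ℝ) • P, hP.smul (by norm_num), fun x u => ?_⟩
  have h1 := h x (Sum.elim (-(C *ᵥ x + D *ᵥ u)) u)
  rw [dilation_supply_neg_output, dilationB_mulVec] at h1
  simp only [smul_mulVec, dotProduct_smul, Complex.smul_re, smul_eq_mul]
  linarith

/-- Bounded real lemma. -/
theorem exists_storage_of_rightHalfPlane_bounded (hctrl : IsControllable A B)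
    (hobs : IsObservable A C) (G : ℂ → Matrix ι ι ℂ)
    (hd : ∀ i j, DifferentiableOn ℂ (fun z => G z i j) rightHalfPlane)
    (hbd : ∀ z ∈ rightHalfPlane, ∀ u, (star (G z *ᵥ u) ⬝ᵥ (G z *ᵥ u)).re ≤ (star u ⬝ᵥ u).re)
    (hG : ∀ z ∈ rightHalfPlane, IsUnit (z • 1 - A).det → G z = D + C * (z • 1 - A)⁻¹ * B) :
    ∃ P : Matrix ν ν ℂ, P.PosDef ∧ ∀ x u,
      2 * (star x ⬝ᵥ (P *ᵥ (A *ᵥ x + B *ᵥ u))).re ≤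
        (star u ⬝ᵥ u).re - (star (C *ᵥ x + D *ᵥ u) ⬝ᵥ (C *ᵥ x + D *ᵥ u)).re := by
  obtain ⟨P, hP, h⟩ := exists_storage_of_rightHalfPlane (D := dilation D) hctrl.dilation
    hobs.dilation (fun z => dilation (G z)) (differentiableOn_dilation hd)
    (fun z hz w => dilation_re_nonneg (hbd z hz) w)
    (fun z hz hdet => by rw [hG z hz hdet, dilation_transfer])
  refine ⟨(2⁻¹ : ℝ) • P, hP.smul (by norm_num), fun x u => ?_⟩
  have h1 := h x (Sum.elim (-(C *ᵥ x + D *ᵥ u)) u)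
  rw [dilation_supply_neg_output, dilationB_mulVec] at h1
  simp only [smul_mulVec, dotProduct_smul, Complex.smul_re, smul_eq_mul]
  linarith

end BoundedReal

end KYP

namespace KYP

/-! ### Evaluation and poles of the transfer function -/

section RationalFunctions

open Polynomial

variable {n m : ℕ} (A : Matrix (Fin n) (Fin n) ℂ) (B : Matrix (Fin n) (Fin m) ℂ)
  (C : Matrix (Fin m) (Fin n) ℂ) (D : Matrix (Fin m) (Fin m) ℂ)

theorem map_charmatrix_ratFunc :
    (algebraMap ℂ[X] (RatFunc ℂ)).mapMatrix A.charmatrix =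
      (RatFunc.X : RatFunc ℂ) • (1 : Matrix (Fin n) (Fin n) (RatFunc ℂ)) - A.map RatFunc.C := by
  ext i j
  by_cases h : i = j
  · subst h
    simp [RatFunc.algebraMap_X, RatFunc.algebraMap_C]
  · simp [h, RatFunc.algebraMap_C]

theorem map_charmatrix_eval (z : ℂ) : (evalRingHom z).mapMatrix A.charmatrix = z • 1 - A := by
  ext i j
  by_cases h : i = j
  · subst h
    simp
  · simp [h]

theorem eval_charpoly_eq_det (z : ℂ) : A.charpoly.eval z = (z • 1 - A).det := by
  rw [eval_charpoly, scalar_apply, smul_one_eq_diagonal]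

theorem isUnit_det_X_sub : IsUnit ((RatFunc.X : RatFunc ℂ) •
    (1 : Matrix (Fin n) (Fin n) (RatFunc ℂ)) - A.map RatFunc.C).det := by
  rw [← map_charmatrix_ratFunc, ← RingHom.map_det, isUnit_iff_ne_zero]
  exact RatFunc.algebraMap_ne_zero A.charpoly_monic.ne_zero

/-- The numerator of the transfer function over the characteristic polynomial of `A`. -/
noncomputable def transferNum : Matrix (Fin m) (Fin m) ℂ[X] :=
  C.map Polynomial.C * A.charmatrix.adjugate * B.map Polynomial.C +
    A.charpoly • D.map Polynomial.C

theorem charpoly_smul_transferFunction :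
    (algebraMap ℂ[X] (RatFunc ℂ) A.charpoly) • transferFunction A B C D =
      (transferNum A B C D).map (algebraMap ℂ[X] (RatFunc ℂ)) := by
  have hC : ∀ {p q : ℕ} (M : Matrix (Fin p) (Fin q) ℂ),
      (M.map Polynomial.C).map (algebraMap ℂ[X] (RatFunc ℂ)) = M.map RatFunc.C := fun M => by
    ext i j
    simp [RatFunc.algebraMap_C]
  have hadj := (algebraMap ℂ[X] (RatFunc ℂ)).map_adjugate A.charmatrix
  have hdet := (algebraMap ℂ[X] (RatFunc ℂ)).map_det A.charmatrix
  rw [map_charmatrix_ratFunc] at hadj hdet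
  rw [RingHom.mapMatrix_apply] at hadj
  have hne : algebraMap ℂ[X] (RatFunc ℂ) A.charpoly ≠ 0 :=
    RatFunc.algebraMap_ne_zero A.charpoly_monic.ne_zero
  have hsmul : (A.charpoly • D.map Polynomial.C).map (algebraMap ℂ[X] (RatFunc ℂ)) =
      algebraMap ℂ[X] (RatFunc ℂ) A.charpoly • D.map RatFunc.C := by
    rw [← hC D]
    ext i j
    simp
  rw [transferNum, Matrix.map_add _ (map_add _), Matrix.map_mul, Matrix.map_mul, hC, hC, hadj,
    hsmul, transferFunction, smul_add, Matrix.inv_def, ← hdet, ← Matrix.charpoly,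
    Ring.inverse_eq_inv', Matrix.mul_smul, Matrix.smul_mul, smul_smul, mul_inv_cancel₀ hne,
    one_smul]

theorem transferFunction_apply (i j : Fin m) :
    transferFunction A B C D i j = algebraMap ℂ[X] (RatFunc ℂ) (transferNum A B C D i j) /
      algebraMap ℂ[X] (RatFunc ℂ) A.charpoly := by
  have hne : algebraMap ℂ[X] (RatFunc ℂ) A.charpoly ≠ 0 :=
    RatFunc.algebraMap_ne_zero A.charpoly_monic.ne_zero
  rw [eq_div_iff hne, mul_comm]
  exact congrFun (congrFun (charpoly_smul_transferFunction A B C D) i) j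

variable {A}

theorem analyticAtPoint_transferFunction {z : ℂ} (hz : IsUnit (z • 1 - A).det) :
    AnalyticAtPoint (transferFunction A B C D) z := fun i j h => by
  rw [transferFunction_apply] at h
  have h0 := eval_eq_zero_of_dvd_of_eval_eq_zero (RatFunc.denom_div_dvd _ _) h
  rw [eval_charpoly_eq_det] at h0
  exact hz.ne_zero h0

/-- Evaluation of rational functions is multiplicative only away from poles. Multiplying by the
characteristic polynomial gives a polynomial identity by Cramer's rule, which can be evaluated and
divided back. -/
theorem evalAt_transferFunction {z : ℂ} (hz : IsUnit (z • 1 - A).det) :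
    evalAt (transferFunction A B C D) z = C * (z • 1 - A)⁻¹ * B + D := by
  have hχ : A.charpoly.eval z ≠ 0 := by
    rw [eval_charpoly_eq_det]
    exact hz.ne_zero
  have h1 : A.charpoly.eval z • evalAt (transferFunction A B C D) z =
      (transferNum A B C D).map (evalRingHom z) := by
    ext i j
    have han := analyticAtPoint_transferFunction B C D hz i j
    have hmul := RatFunc.eval_mul (f := RingHom.id ℂ) (a := z)
      (x := algebraMap ℂ[X] (RatFunc ℂ) A.charpoly) (y := transferFunction A B C D i j)
      (by simp [RatFunc.denom_algebraMap]) han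
    have hsm := congrFun (congrFun (charpoly_smul_transferFunction A B C D) i) j
    rw [Matrix.smul_apply, smul_eq_mul] at hsm
    rw [hsm, Matrix.map_apply, RatFunc.eval_algebraMap, RatFunc.eval_algebraMap] at hmul
    exact hmul.symm
  have hC : ∀ {p q : ℕ} (M : Matrix (Fin p) (Fin q) ℂ),
      (M.map Polynomial.C).map (evalRingHom z) = M := fun M => by
    ext i j
    simp
  have hadj := (evalRingHom z).map_adjugate A.charmatrix
  rw [map_charmatrix_eval, RingHom.mapMatrix_apply] at hadj
  have hsmul : (A.charpoly • D.map Polynomial.C).map (evalRingHom z) =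
      A.charpoly.eval z • D := by
    ext i j
    simp
  have h2 : A.charpoly.eval z • evalAt (transferFunction A B C D) z =
      A.charpoly.eval z • (C * (z • 1 - A)⁻¹ * B + D) := by
    rw [h1, transferNum, Matrix.map_add _ (map_add _), Matrix.map_mul, Matrix.map_mul, hC, hC,
      hadj, hsmul, smul_add, Matrix.inv_def, ← eval_charpoly_eq_det, Ring.inverse_eq_inv',
      Matrix.mul_smul, Matrix.smul_mul, smul_smul, mul_inv_cancel₀ hχ, one_smul]
  exact smul_right_injective _ hχ h2

theorem differentiableOn_evalAt {F : RatMat m} {Ω : Set ℂ} (h : ∀ z ∈ Ω, AnalyticAtPoint F z)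
    (i j : Fin m) : DifferentiableOn ℂ (fun z => evalAt F z i j) Ω := by
  have h1 : (fun z => evalAt F z i j) = fun z => (F i j).num.eval z / (F i j).denom.eval z := by
    ext z
    simp [evalAt, RatFunc.eval, Polynomial.eval₂_id]
  rw [h1]
  exact (Polynomial.differentiable _).differentiableOn.div
    (Polynomial.differentiable _).differentiableOn fun z hz => h z hz i j

end RationalFunctions

/-! ### Minimal realizations are controllable and observable -/

section Minimality

variable {n k m : ℕ} {A : Matrix (Fin n) (Fin n) ℂ} {B : Matrix (Fin n) (Fin m) ℂ}
  {C : Matrix (Fin m) (Fin n) ℂ} {D : Matrix (Fin m) (Fin m) ℂ} {F : RatMat m}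

/-- Intertwining passes to the resolvents. `X` may be rectangular, so inclusions of subspaces and
quotient maps are both covered. -/
theorem transferFunction_eq_of_intertwine {A' : Matrix (Fin k) (Fin k) ℂ}
    {B' : Matrix (Fin k) (Fin m) ℂ} {C' : Matrix (Fin m) (Fin k) ℂ}
    (X : Matrix (Fin k) (Fin n) ℂ) (hA : X * A = A' * X) (hB : X * B = B') (hC : C' * X = C) :
    transferFunction A B C D = transferFunction A' B' C' D := by
  subst hB hC
  have hA2 := congrArg (fun M => M.map (RatFunc.C : ℂ →+* RatFunc ℂ)) hA
  simp only [Matrix.map_mul] at hA2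
  set S := (RatFunc.X : RatFunc ℂ) • (1 : Matrix (Fin n) (Fin n) (RatFunc ℂ)) - A.map RatFunc.C
    with hS
  set S' := (RatFunc.X : RatFunc ℂ) • (1 : Matrix (Fin k) (Fin k) (RatFunc ℂ)) -
    A'.map RatFunc.C with hS'
  have hXS : X.map RatFunc.C * S = S' * X.map RatFunc.C := by
    rw [hS, hS', Matrix.mul_sub, Matrix.sub_mul, hA2]
    simp
  have hinv : X.map RatFunc.C * S⁻¹ = S'⁻¹ * X.map RatFunc.C := by
    calc X.map RatFunc.C * S⁻¹ = S'⁻¹ * S' * X.map RatFunc.C * S⁻¹ := by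
          rw [Matrix.nonsing_inv_mul _ (isUnit_det_X_sub A'), Matrix.one_mul]
      _ = S'⁻¹ * (X.map RatFunc.C * S) * S⁻¹ := by rw [hXS, Matrix.mul_assoc S'⁻¹]
      _ = S'⁻¹ * X.map RatFunc.C := by
          rw [← Matrix.mul_assoc, Matrix.mul_assoc _ S,
            Matrix.mul_nonsing_inv _ (isUnit_det_X_sub A), Matrix.mul_one]
  rw [transferFunction, transferFunction, Matrix.map_mul, Matrix.map_mul, ← hS, ← hS',
    Matrix.mul_assoc (C'.map _), hinv]
  simp only [Matrix.mul_assoc]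

theorem le_of_isMinimalRealization (h : IsMinimalRealization A B C D F)
    {A' : Matrix (Fin k) (Fin k) ℂ} {B' : Matrix (Fin k) (Fin m) ℂ}
    {C' : Matrix (Fin m) (Fin k) ℂ} (h' : transferFunction A B C D = transferFunction A' B' C' D) :
    n ≤ k := by
  rw [h.2]
  exact Nat.sInf_le ⟨A', B', C', D, h.1.trans h'⟩

/-- Restricting the system to a proper invariant subspace containing the range of `B` would realize
`F` in smaller dimension. -/
theorem isControllable_of_isMinimalRealization (h : IsMinimalRealization A B C D F) :
    IsControllable A B := fun V hA hB => by
  by_contra hV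
  let e : V ≃ₗ[ℂ] (Fin (Module.finrank ℂ V) → ℂ) := (Module.finBasis ℂ V).equivFun
  let J := LinearMap.toMatrix' (V.subtype ∘ₗ e.symm.toLinearMap)
  let A' := LinearMap.toMatrix' (e.toLinearMap ∘ₗ A.mulVecLin.restrict hA ∘ₗ e.symm.toLinearMap)
  let B' := LinearMap.toMatrix' (e.toLinearMap ∘ₗ B.mulVecLin.codRestrict V hB)
  have hle := le_of_isMinimalRealization h (transferFunction_eq_of_intertwine (A := A') (B := B')
    (C := C * J) J (Matrix.toLin'.injective (LinearMap.ext fun x => by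
      simp [J, A', Matrix.toLin'_mul]
      rfl))
    (Matrix.toLin'.injective (LinearMap.ext fun x => by
      simp [J, B', Matrix.toLin'_mul]
      rfl)) rfl).symm
  have hlt := Submodule.finrank_lt hV
  rw [Module.finrank_fin_fun] at hlt
  omega

/-- Dually, the system descends to the quotient by an invariant subspace of the kernel of `C`. -/
theorem isObservable_of_isMinimalRealization (h : IsMinimalRealization A B C D F) :
    IsObservable A C := fun V hA hC => by
  by_contra hV
  let W := (Fin n → ℂ) ⧸ V
  let e : W ≃ₗ[ℂ] (Fin (Module.finrank ℂ W) → ℂ) := (Module.finBasis ℂ W).equivFun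
  let X := LinearMap.toMatrix' (e.toLinearMap ∘ₗ V.mkQ)
  let A' := LinearMap.toMatrix' (e.toLinearMap ∘ₗ V.mapQ V A.mulVecLin hA ∘ₗ e.symm.toLinearMap)
  let C' := LinearMap.toMatrix' (V.liftQ C.mulVecLin (fun x hx => hC x hx) ∘ₗ e.symm.toLinearMap)
  have hle := le_of_isMinimalRealization h (transferFunction_eq_of_intertwine (A' := A')
    (B' := X * B) (C' := C') X (Matrix.toLin'.injective (LinearMap.ext fun x => by
      simp [X, A', Matrix.toLin'_mul]
      rfl)) rfl
    (Matrix.toLin'.injective (LinearMap.ext fun x => by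
      simp [X, C', Matrix.toLin'_mul]
      rfl)))
  have hsum := Submodule.finrank_quotient_add_finrank V
  rw [Module.finrank_fin_fun] at hsum
  have hpos := Submodule.one_le_finrank_iff.2 hV
  change n ≤ Module.finrank ℂ ((Fin n → ℂ) ⧸ V) at hle
  omega

end Minimality

/-! ### Condition (1) as a dissipation inequality -/

section QuadraticForms

theorem posSemidef_iff_re {κ : Type*} [Fintype κ] {M : Matrix κ κ ℂ} (hM : M.IsHermitian) :
    M.PosSemidef ↔ ∀ v, 0 ≤ (star v ⬝ᵥ (M *ᵥ v)).re := by
  rw [posSemidef_iff_dotProduct_mulVec]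
  refine ⟨fun h v => (Complex.nonneg_iff.1 (h.2 v)).1, fun h => ⟨hM, fun v => ?_⟩⟩
  exact Complex.nonneg_iff.2 ⟨h v, (hM.im_star_dotProduct_mulVec_self v).symm⟩

theorem stackOne_form {κ : Type*} [Fintype κ] [DecidableEq κ] (M : Matrix κ κ ℂ)
    (W : Matrix (κ ⊕ κ) (κ ⊕ κ) ℂ) (v : κ → ℂ) :
    star v ⬝ᵥ (((stackOne M)ᴴ * W * stackOne M) *ᵥ v) =
      star (Sum.elim (M *ᵥ v) v) ⬝ᵥ (W *ᵥ Sum.elim (M *ᵥ v) v) := by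
  have h : stackOne M *ᵥ v = Sum.elim (M *ᵥ v) v := by
    rw [stackOne, fromRows_mulVec, one_mulVec]
  rw [← h, star_mulVec, ← dotProduct_mulVec, mulVec_mulVec, mulVec_mulVec, Matrix.mul_assoc]

theorem star_sumElim {κ μ : Type*} (v : κ → ℂ) (u : μ → ℂ) :
    star (Sum.elim v u) = Sum.elim (star v) (star u) := by
  ext (i | i) <;> rfl

variable {m : ℕ} {M : Matrix (Fin m) (Fin m) ℂ}

theorem mem_lyapunovSet_one_iff : M ∈ lyapunovSet 1 ↔ ∀ u, 0 ≤ (star u ⬝ᵥ (M *ᵥ u)).re := by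
  have hH : ((stackOne M)ᴴ * (fromBlocks 0 1 1 0 : Matrix (Fin m ⊕ Fin m) (Fin m ⊕ Fin m) ℂ) *
      stackOne M).IsHermitian := by
    refine isHermitian_conjTranspose_mul_mul _ ?_
    simp [Matrix.IsHermitian, fromBlocks_conjTranspose]
  rw [lyapunovSet, Set.mem_ofPred_eq, posSemidef_iff_re hH]
  refine forall_congr' fun u => ?_
  rw [stackOne_form, fromBlocks_mulVec, star_sumElim, sumElim_dotProduct_sumElim]
  simp only [Sum.elim_comp_inl, Sum.elim_comp_inr, zero_mulVec, one_mulVec, zero_add, add_zero,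
    Complex.add_re]
  rw [re_star_dotProduct_comm (M *ᵥ u) u]
  constructor <;> intro h <;> linarith

theorem mem_steinSet_one_iff : M ∈ steinSet 1 ↔
    ∀ u, (star (M *ᵥ u) ⬝ᵥ (M *ᵥ u)).re ≤ (star u ⬝ᵥ u).re := by
  have hH : ((stackOne M)ᴴ * (fromBlocks (-1) 0 0 1 : Matrix (Fin m ⊕ Fin m) (Fin m ⊕ Fin m) ℂ) *
      stackOne M).IsHermitian := by
    refine isHermitian_conjTranspose_mul_mul _ ?_
    simp [Matrix.IsHermitian, fromBlocks_conjTranspose]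
  rw [steinSet, Set.mem_ofPred_eq, posSemidef_iff_re hH]
  refine forall_congr' fun u => ?_
  rw [stackOne_form, fromBlocks_mulVec, star_sumElim, sumElim_dotProduct_sumElim]
  simp only [Sum.elim_comp_inl, Sum.elim_comp_inr, zero_mulVec, one_mulVec, zero_add, add_zero,
    Complex.add_re, neg_mulVec, dotProduct_neg, Complex.neg_re]
  constructor <;> intro h <;> linarith

variable {n : ℕ} {P A : Matrix (Fin n) (Fin n) ℂ} {B : Matrix (Fin n) (Fin m) ℂ}
  {C : Matrix (Fin m) (Fin n) ℂ} {D : Matrix (Fin m) (Fin m) ℂ}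

theorem isHermitian_Q (l : Label) (hP : P.IsHermitian) : (Q l P A B C D).IsHermitian := by
  refine isHermitian_conjTranspose_mul_mul _ ?_
  cases l <;> simp [W, Matrix.IsHermitian, fromBlocks_conjTranspose, hP.eq]

theorem posSemidef_Q_iff (l : Label) (hP : P.IsHermitian) :
    (Q l P A B C D).PosSemidef ↔ ∀ x u,
      0 ≤ (star (Sum.elim (Sum.elim (A *ᵥ x + B *ᵥ u) (C *ᵥ x + D *ᵥ u)) (Sum.elim x u)) ⬝ᵥ
        (W l m P *ᵥ
          Sum.elim (Sum.elim (A *ᵥ x + B *ᵥ u) (C *ᵥ x + D *ᵥ u)) (Sum.elim x u))).re := by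
  rw [posSemidef_iff_re (isHermitian_Q l hP)]
  have key : ∀ x u, star (Sum.elim x u) ⬝ᵥ (Q l P A B C D *ᵥ Sum.elim x u) =
      star (Sum.elim (Sum.elim (A *ᵥ x + B *ᵥ u) (C *ᵥ x + D *ᵥ u)) (Sum.elim x u)) ⬝ᵥ
        (W l m P *ᵥ
          Sum.elim (Sum.elim (A *ᵥ x + B *ᵥ u) (C *ᵥ x + D *ᵥ u)) (Sum.elim x u)) := by
    intro x u
    rw [Q, stackOne_form, fromBlocks_mulVec, Sum.elim_comp_inl, Sum.elim_comp_inr]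
  simp only [← key]
  refine ⟨fun h x u => h _, fun h v => ?_⟩
  rw [← Sum.elim_comp_inl_inr v]
  exact h _ _

theorem posSemidef_Q_alpha_iff (hP : P.IsHermitian) :
    (Q .alpha P A B C D).PosSemidef ↔ ∀ x u,
      (star x ⬝ᵥ (P *ᵥ (A *ᵥ x + B *ᵥ u))).re ≤ (star u ⬝ᵥ (C *ᵥ x + D *ᵥ u)).re := by
  rw [posSemidef_Q_iff _ hP]
  refine forall_congr' fun x => forall_congr' fun u => ?_
  simp only [W, fromBlocks_mulVec, star_sumElim, sumElim_dotProduct_sumElim, Sum.elim_comp_inl,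
    Sum.elim_comp_inr, zero_mulVec, one_mulVec, zero_add, add_zero, neg_mulVec, dotProduct_neg,
    Complex.add_re, Complex.neg_re]
  rw [re_star_dotProduct_comm (C *ᵥ x + D *ᵥ u) u,
    re_dotProduct_mulVec_comm hP (A *ᵥ x + B *ᵥ u) x]
  constructor <;> intro h <;> linarith

theorem posSemidef_Q_beta_iff (hP : P.IsHermitian) :
    (Q .beta P A B C D).PosSemidef ↔ ∀ x u,
      2 * (star x ⬝ᵥ (P *ᵥ (A *ᵥ x + B *ᵥ u))).re ≤
        (star u ⬝ᵥ u).re - (star (C *ᵥ x + D *ᵥ u) ⬝ᵥ (C *ᵥ x + D *ᵥ u)).re := by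
  rw [posSemidef_Q_iff _ hP]
  refine forall_congr' fun x => forall_congr' fun u => ?_
  simp only [W, fromBlocks_mulVec, star_sumElim, Sum.elim_comp_inl, Sum.elim_comp_inr,
    zero_mulVec, one_mulVec, zero_add, add_zero, neg_mulVec, ← Sum.elim_add_add,
    sumElim_dotProduct_sumElim, dotProduct_neg, Complex.add_re, Complex.neg_re]
  rw [re_dotProduct_mulVec_comm hP (A *ᵥ x + B *ᵥ u) x]
  constructor <;> intro h <;> linarith

theorem posSemidef_Q_gamma_iff (hP : P.IsHermitian) :
    (Q .gamma P A B C D).PosSemidef ↔ ∀ x u,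
      (star (A *ᵥ x + B *ᵥ u) ⬝ᵥ (P *ᵥ (A *ᵥ x + B *ᵥ u))).re ≤
        (star x ⬝ᵥ (P *ᵥ x)).re + 2 * (star u ⬝ᵥ (C *ᵥ x + D *ᵥ u)).re := by
  rw [posSemidef_Q_iff _ hP]
  refine forall_congr' fun x => forall_congr' fun u => ?_
  simp only [W, fromBlocks_mulVec, star_sumElim, Sum.elim_comp_inl, Sum.elim_comp_inr,
    zero_mulVec, one_mulVec, zero_add, add_zero, neg_mulVec, ← Sum.elim_add_add,
    sumElim_dotProduct_sumElim, dotProduct_neg, Complex.add_re, Complex.neg_re]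
  rw [re_star_dotProduct_comm (C *ᵥ x + D *ᵥ u) u]
  constructor <;> intro h <;> linarith

theorem posSemidef_Q_delta_iff (hP : P.IsHermitian) :
    (Q .delta P A B C D).PosSemidef ↔ ∀ x u,
      (star (A *ᵥ x + B *ᵥ u) ⬝ᵥ (P *ᵥ (A *ᵥ x + B *ᵥ u))).re ≤
        (star x ⬝ᵥ (P *ᵥ x)).re + (star u ⬝ᵥ u).re -
          (star (C *ᵥ x + D *ᵥ u) ⬝ᵥ (C *ᵥ x + D *ᵥ u)).re := by
  rw [posSemidef_Q_iff _ hP]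
  refine forall_congr' fun x => forall_congr' fun u => ?_
  simp only [W, fromBlocks_mulVec, star_sumElim, Sum.elim_comp_inl, Sum.elim_comp_inr,
    zero_mulVec, one_mulVec, zero_add, add_zero, neg_mulVec,
    sumElim_dotProduct_sumElim, dotProduct_neg, Complex.add_re, Complex.neg_re]
  constructor <;> intro h <;> linarith

end QuadraticForms

/-! ### Real storage matrices for real data -/

section RealStorage

variable {n m : ℕ} {P A : Matrix (Fin n) (Fin n) ℂ} {B : Matrix (Fin n) (Fin m) ℂ}
  {C : Matrix (Fin m) (Fin n) ℂ} {D : Matrix (Fin m) (Fin m) ℂ}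

theorem IsRealMatrix.conjTranspose_eq {κ μ : Type*} {M : Matrix κ μ ℂ} (h : IsRealMatrix M) :
    Mᴴ = Mᵀ := by
  ext i j
  exact Complex.conj_eq_iff_im.2 (h j i)

theorem Q_transpose (l : Label) (hA : IsRealMatrix A) (hB : IsRealMatrix B) (hC : IsRealMatrix C)
    (hD : IsRealMatrix D) : Q l Pᵀ A B C D = (Q l P A B C D)ᵀ := by
  have hS : IsRealMatrix (stackOne (fromBlocks A B C D)) := by
    rintro ((i | i) | i) (j | j)
    · exact hA i j
    · exact hB i j
    · exact hC i j
    · exact hD i j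
    all_goals
      simp only [stackOne, fromRows_apply_inr, one_apply]
      split_ifs <;> simp
  have hW : W l m Pᵀ = (W l m P)ᵀ := by
    cases l <;> simp [W, fromBlocks_transpose]
  rw [Q, Q, hS.conjTranspose_eq, Matrix.transpose_mul, Matrix.transpose_mul, transpose_transpose,
    hW, Matrix.mul_assoc]

/-- Because of its identity blocks, `W` is affine and not linear in `P`; midpoints are preserved
although sums are not. -/
theorem Q_midpoint (l : Label) (P P' : Matrix (Fin n) (Fin n) ℂ) :
    Q l ((2⁻¹ : ℝ) • (P + P')) A B C D = (2⁻¹ : ℝ) • (Q l P A B C D + Q l P' A B C D) := by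
  have hW : W l m ((2⁻¹ : ℝ) • (P + P')) = (2⁻¹ : ℝ) • (W l m P + W l m P') := by
    have h1 : (1 : Matrix (Fin m) (Fin m) ℂ) = (2⁻¹ : ℝ) • (1 + 1) := by
      rw [← two_smul ℝ, smul_smul]
      norm_num
    have h2 : (-1 : Matrix (Fin m) (Fin m) ℂ) = (2⁻¹ : ℝ) • (-1 + -1) := by
      rw [← two_smul ℝ, smul_smul]
      norm_num
    cases l <;>
      simp only [W, fromBlocks_add, fromBlocks_smul, add_zero, smul_zero, ← h1, ← h2, smul_add,
        smul_neg, neg_add]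
  rw [Q, Q, Q, hW, Matrix.mul_smul, Matrix.smul_mul, Matrix.mul_add, Matrix.add_mul]

/-- For real data `Pᵀ` is again a solution. Being Hermitian, `P` has `Pᵀ` as its entrywise
conjugate, so the midpoint is real. -/
theorem exists_real_storage (l : Label) (hA : IsRealMatrix A) (hB : IsRealMatrix B)
    (hC : IsRealMatrix C) (hD : IsRealMatrix D) (hP : P.PosDef)
    (hQ : (Q l P A B C D).PosSemidef) :
    ∃ P : Matrix (Fin n) (Fin n) ℂ, IsRealMatrix P ∧ P.PosDef ∧ (Q l P A B C D).PosSemidef := by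
  refine ⟨(2⁻¹ : ℝ) • (P + Pᵀ), fun i j => ?_, (hP.add hP.transpose).smul (by norm_num), ?_⟩
  · have h : P j i = star (P i j) := (hP.isHermitian.apply j i).symm
    simp [h]
  · rw [Q_midpoint, Q_transpose l hA hB hC hD]
    exact (hQ.add hQ.transpose).smul (by norm_num)

end RealStorage

/-! ### The two directions of the theorem -/

section Main

variable {n m : ℕ} {P A : Matrix (Fin n) (Fin n) ℂ} {B : Matrix (Fin n) (Fin m) ℂ}
  {C : Matrix (Fin m) (Fin n) ℂ} {D : Matrix (Fin m) (Fin m) ℂ} {F : RatMat m}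

/-- The value `F(z)` enters only through the exponential response: `x = (z - A)⁻¹ B u` solves `A x +
B u = z x` and has output `F(z) u`. The first hypothesis keeps the spectrum of `A` out of the
region. -/
theorem mapsAnalytically_transferFunction {Ω : Set ℂ} {S : Set (Matrix (Fin m) (Fin m) ℂ)}
    (hspec : ∀ z ∈ Ω, ∀ x, A *ᵥ x = z • x → x = 0)
    (hS : ∀ z ∈ Ω, ∀ M : Matrix (Fin m) (Fin m) ℂ,
      (∀ u, ∃ x, A *ᵥ x + B *ᵥ u = z • x ∧ M *ᵥ u = C *ᵥ x + D *ᵥ u) → M ∈ S) :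
    MapsAnalytically (transferFunction A B C D) Ω S := fun z hz => by
  have hdet : IsUnit (z • 1 - A).det := isUnit_iff_ne_zero.2 fun h => by
    obtain ⟨x, hx, hx0⟩ := exists_mulVec_eq_zero_iff.2 h
    rw [sub_mulVec, smul_mulVec, one_mulVec, sub_eq_zero] at hx0
    exact hx (hspec z hz x hx0.symm)
  refine ⟨analyticAtPoint_transferFunction B C D hdet, hS z hz _ fun u => ?_⟩
  refine ⟨(z • 1 - A)⁻¹ *ᵥ (B *ᵥ u), ?_, ?_⟩
  · have h : (z • 1 - A) *ᵥ ((z • 1 - A)⁻¹ *ᵥ (B *ᵥ u)) = B *ᵥ u := by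
      rw [mulVec_mulVec, mul_nonsing_inv _ hdet, one_mulVec]
    rw [sub_mulVec, smul_mulVec, one_mulVec] at h
    exact (sub_eq_iff_eq_add'.1 h).symm
  · rw [evalAt_transferFunction B C D hdet, add_mulVec]
    simp only [mulVec_mulVec, Matrix.mul_assoc]

theorem re_form_smul (hP : P.PosDef) (z : ℂ) (x : Fin n → ℂ) :
    (star x ⬝ᵥ (P *ᵥ (z • x))).re = z.re * (star x ⬝ᵥ (P *ᵥ x)).re := by
  have him : (star x ⬝ᵥ (P *ᵥ x)).im = 0 := hP.isHermitian.im_star_dotProduct_mulVec_self x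
  rw [mulVec_smul, dotProduct_smul, smul_eq_mul, Complex.mul_re, him, mul_zero, sub_zero]

theorem re_form_smul_smul (z : ℂ) (x : Fin n → ℂ) :
    (star (z • x) ⬝ᵥ (P *ᵥ (z • x))).re = ‖z‖ ^ 2 * (star x ⬝ᵥ (P *ᵥ x)).re := by
  rw [mulVec_smul, dotProduct_smul, star_smul, smul_dotProduct, smul_smul, smul_eq_mul,
    show z * star z = ((‖z‖ ^ 2 : ℝ) : ℂ) by simpa using Complex.mul_conj' z,
    Complex.re_ofReal_mul]

theorem re_form_nonneg (hP : P.PosDef) (x : Fin n → ℂ) : 0 ≤ (star x ⬝ᵥ (P *ᵥ x)).re :=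
  (Complex.nonneg_iff.1 (hP.posSemidef.dotProduct_mulVec_nonneg x)).1

theorem eq_zero_of_re_form_nonpos (hP : P.PosDef) {x : Fin n → ℂ}
    (h : (star x ⬝ᵥ (P *ᵥ x)).re ≤ 0) : x = 0 := by
  by_contra hx
  exact h.not_gt (Complex.pos_iff.1 (hP.dotProduct_mulVec_pos hx)).1

theorem re_star_dotProduct_self_nonneg {κ : Type*} [Fintype κ] (y : κ → ℂ) :
    0 ≤ (star y ⬝ᵥ y).re :=
  (Complex.nonneg_iff.1 (dotProduct_star_self_nonneg y)).1

theorem inFamily_of_posSemidef_Q (l : Label) (hreal : IsRealRational F)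
    (hF : IsRealization A B C D F) (hP : P.PosDef) (hQ : (Q l P A B C D).PosSemidef) :
    InFamily l F := by
  have hH := hP.isHermitian
  rw [IsRealization] at hF
  cases l with
  | alpha =>
    rw [posSemidef_Q_alpha_iff hH] at hQ
    refine ⟨hreal, hF ▸ mapsAnalytically_transferFunction (fun z hz x hx => ?_) fun z hz M hM =>
      mem_lyapunovSet_one_iff.2 fun u => ?_⟩
    -- With zero input, an eigenvector for `z` would have nonpositive storage.
    · have hz' : 0 < z.re := hz
      have h := hQ x 0
      simp only [mulVec_zero, add_zero, hx, re_form_smul hP, star_zero, zero_dotProduct,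
        Complex.zero_re] at h
      exact eq_zero_of_re_form_nonpos hP (nonpos_of_mul_nonpos_right h hz')
    · have hz' : 0 < z.re := hz
      obtain ⟨x, hx, hMu⟩ := hM u
      have h := hQ x u
      rw [hx, ← hMu, re_form_smul hP] at h
      exact (mul_nonneg hz'.le (re_form_nonneg hP x)).trans h
  | beta =>
    rw [posSemidef_Q_beta_iff hH] at hQ
    refine ⟨hreal, hF ▸ mapsAnalytically_transferFunction (fun z hz x hx => ?_) fun z hz M hM =>
      mem_steinSet_one_iff.2 fun u => ?_⟩
    · have hz' : 0 < z.re := hz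
      have h := hQ x 0
      simp only [mulVec_zero, add_zero, hx, re_form_smul hP, star_zero, zero_dotProduct,
        Complex.zero_re] at h
      have h' := re_star_dotProduct_self_nonneg (C *ᵥ x)
      exact eq_zero_of_re_form_nonpos hP
        (nonpos_of_mul_nonpos_right (by linarith : z.re * _ ≤ 0) hz')
    · have hz' : 0 < z.re := hz
      obtain ⟨x, hx, hMu⟩ := hM u
      have h := hQ x u
      rw [hx, ← hMu, re_form_smul hP] at h
      linarith [mul_nonneg hz'.le (re_form_nonneg hP x)]
  | gamma =>
    rw [posSemidef_Q_gamma_iff hH] at hQ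
    refine ⟨hreal, hF ▸ mapsAnalytically_transferFunction (fun z hz x hx => ?_) fun z hz M hM =>
      mem_lyapunovSet_one_iff.2 fun u => ?_⟩
    · have hz' : 1 < ‖z‖ ^ 2 := one_lt_pow₀ hz two_ne_zero
      have h := hQ x 0
      simp only [mulVec_zero, add_zero, hx, re_form_smul_smul, star_zero, zero_dotProduct,
        Complex.zero_re, mul_zero] at h
      exact eq_zero_of_re_form_nonpos hP
        (nonpos_of_mul_nonpos_right (by linarith : (‖z‖ ^ 2 - 1) * _ ≤ 0) (sub_pos.2 hz'))
    · have hz' : 1 < ‖z‖ ^ 2 := one_lt_pow₀ hz two_ne_zero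
      obtain ⟨x, hx, hMu⟩ := hM u
      have h := hQ x u
      rw [hx, ← hMu, re_form_smul_smul] at h
      linarith [mul_nonneg (sub_pos.2 hz').le (re_form_nonneg hP x)]
  | delta =>
    rw [posSemidef_Q_delta_iff hH] at hQ
    refine ⟨hreal, hF ▸ mapsAnalytically_transferFunction (fun z hz x hx => ?_) fun z hz M hM =>
      mem_steinSet_one_iff.2 fun u => ?_⟩
    · have hz' : 1 < ‖z‖ ^ 2 := one_lt_pow₀ hz two_ne_zero
      have h := hQ x 0
      simp only [mulVec_zero, add_zero, hx, re_form_smul_smul, star_zero, zero_dotProduct,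
        Complex.zero_re] at h
      have h' := re_star_dotProduct_self_nonneg (C *ᵥ x)
      exact eq_zero_of_re_form_nonpos hP
        (nonpos_of_mul_nonpos_right (by linarith : (‖z‖ ^ 2 - 1) * _ ≤ 0) (sub_pos.2 hz'))
    · have hz' : 1 < ‖z‖ ^ 2 := one_lt_pow₀ hz two_ne_zero
      obtain ⟨x, hx, hMu⟩ := hM u
      have h := hQ x u
      rw [hx, ← hMu, re_form_smul_smul] at h
      linarith [mul_nonneg (sub_pos.2 hz').le (re_form_nonneg hP x)]

theorem exists_posDef_of_inFamily (l : Label) (hmin : IsMinimalRealization A B C D F)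
    (h : InFamily l F) : ∃ P : Matrix (Fin n) (Fin n) ℂ, P.PosDef ∧ (Q l P A B C D).PosSemidef := by
  have hctrl := isControllable_of_isMinimalRealization hmin
  have hobs := isObservable_of_isMinimalRealization hmin
  have hG : ∀ z, IsUnit (z • 1 - A).det → evalAt F z = D + C * (z • 1 - A)⁻¹ * B :=
    fun z hz => by rw [hmin.1, evalAt_transferFunction B C D hz, add_comm]
  cases l with
  | alpha =>
    obtain ⟨P, hP, hd⟩ := exists_storage_of_rightHalfPlane hctrl hobs (evalAt F)
      (differentiableOn_evalAt fun z hz => (h.2 z hz).1)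
      (fun z hz => mem_lyapunovSet_one_iff.1 (h.2 z hz).2) fun z _ => hG z
    exact ⟨P, hP, (posSemidef_Q_alpha_iff hP.isHermitian).2 hd⟩
  | beta =>
    obtain ⟨P, hP, hd⟩ := exists_storage_of_rightHalfPlane_bounded hctrl hobs (evalAt F)
      (differentiableOn_evalAt fun z hz => (h.2 z hz).1)
      (fun z hz => mem_steinSet_one_iff.1 (h.2 z hz).2) fun z _ => hG z
    exact ⟨P, hP, (posSemidef_Q_beta_iff hP.isHermitian).2 hd⟩
  | gamma =>
    obtain ⟨P, hP, hd⟩ := exists_storage_of_diskExterior hctrl hobs (evalAt F)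
      (differentiableOn_evalAt fun z hz => (h.2 z hz).1)
      (fun z hz => mem_lyapunovSet_one_iff.1 (h.2 z hz).2) fun z _ => hG z
    exact ⟨P, hP, (posSemidef_Q_gamma_iff hP.isHermitian).2 hd⟩
  | delta =>
    obtain ⟨P, hP, hd⟩ := exists_storage_of_diskExterior_bounded hctrl hobs (evalAt F)
      (differentiableOn_evalAt fun z hz => (h.2 z hz).1)
      (fun z hz => mem_steinSet_one_iff.1 (h.2 z hz).2) fun z _ => hG z
    exact ⟨P, hP, (posSemidef_Q_delta_iff hP.isHermitian).2 hd⟩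

end Main

end KYP

theorem mainTheorem1 (l : KYP.Label) {n m : ℕ}
    (A : Matrix (Fin n) (Fin n) ℂ) (B : Matrix (Fin n) (Fin m) ℂ)
    (C : Matrix (Fin m) (Fin n) ℂ) (D : Matrix (Fin m) (Fin m) ℂ)
    (F : KYP.RatMat m) (hreal : KYP.IsRealRational F) (hF : KYP.IsRealization A B C D F) :
    (∀ P : Matrix (Fin n) (Fin n) ℂ, P.PosDef → (KYP.Q l P A B C D).PosSemidef →
      KYP.InFamily l F) ∧
    (KYP.IsMinimalRealization A B C D F → KYP.InFamily l F →
      (∃ P : Matrix (Fin n) (Fin n) ℂ, P.PosDef ∧ (KYP.Q l P A B C D).PosSemidef) ∧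
      (KYP.IsRealMatrix A → KYP.IsRealMatrix B → KYP.IsRealMatrix C → KYP.IsRealMatrix D →
        ∃ P : Matrix (Fin n) (Fin n) ℂ, KYP.IsRealMatrix P ∧ P.PosDef ∧
          (KYP.Q l P A B C D).PosSemidef)) := by
  refine ⟨fun P hP hQ => KYP.inFamily_of_posSemidef_Q l hreal hF hP hQ, fun hmin hfam => ?_⟩
  obtain ⟨P, hP, hQ⟩ := KYP.exists_posDef_of_inFamily l hmin hfam
  exact ⟨⟨P, hP, hQ⟩, fun hA hB hC hD => KYP.exists_real_storage l hA hB hC hD hP hQ⟩
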